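/- For a nonnegative integer $k$ let $H_k$ be the real vector space of $k\times k$ complex Hermitian matrices, $D_k\subset H_k$ the set of positive semidefinite matrices of trace one, and $P_k\subset D_k$ the set of Hermitian matrices of rank one and trace one (pure states). Let $m,n$ be nonnegative integers, identify $H_{mn}$ with $H_m\otimes H_n$ through the Kronecker product, and put $$P_m\otimes P_n=\{P\otimes Q: P\in P_m,\ Q\in P_n\},\qquad S_{m,n}=\operatorname{conv}\{A\otimes B: A\in D_m,\ B\in D_n\}.$$ Let $\Psi:H_{mn}\to H_{mn}$ be a real-linear map. The following are equivalent: (a) $\Psi(P_m\otimes P_n)=P_m\otimes P_n$; (b) $\Psi(S_{m,n})=S_{m,n}$; (c) there are unitary matrices $U\in M_m(\mathbb C)$ and $V\in M_n(\mathbb C)$, a map $\psi_1:H_m\to H_m$ of the form $A\mapsto UAU^*$ or $A\mapsto UA^{T}U^*$, and a map $\psi_2:H_n\to H_n$ of the form $B\mapsto VBV^*$ or $B\mapsto VB^{T}V^*$, such that either (c.1) $\Psi(A\otimes B)=\psi_1(A)\otimes\psi_2(B)$ for all $A\in H_m$, $B\in H_n$, or (c.2) $m=n$ and $\Psi(A\otimes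 B)=\psi_2(B)\otimes\psi_1(A)$ for all $A\in H_m$, $B\in H_n$. -/

import Mathlib

open scoped Kronecker ComplexOrder

namespace SepStates

/-- The real vector space of complex Hermitian matrices with rows and columns indexed by `ι`. -/
abbrev Herm (ι : Type) : Type := selfAdjoint (Matrix ι ι ℂ)

/-- The Kronecker product `A ⊗ B` of two Hermitian matrices, a Hermitian matrix indexed by
pairs; the Hermitian matrices of order `mn` are those indexed by `Fin m × Fin n`. -/
def kron {m n : ℕ} (A : Herm (Fin m)) (B : Herm (Fin n)) : Herm (Fin m × Fin n) :=
  ⟨(A : Matrix (Fin m) (Fin m) ℂ) ⊗ₖ (B : Matrix (Fin n) (Fin n) ℂ), by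
    have hA := selfAdjoint.mem_iff.1 A.2
    have hB := selfAdjoint.mem_iff.1 B.2
    rw [Matrix.star_eq_conjTranspose] at hA hB
    rw [selfAdjoint.mem_iff, Matrix.star_eq_conjTranspose, Matrix.conjTranspose_kronecker,
      hA, hB]⟩

/-- Density matrices: positive semidefinite of trace one. -/
def density (n : ℕ) : Set (Herm (Fin n)) :=
  {A | (A : Matrix (Fin n) (Fin n) ℂ).PosSemidef ∧ (A : Matrix (Fin n) (Fin n) ℂ).trace = 1}

/-- Pure states: Hermitian matrices of rank one and trace one. -/
def pureStates (n : ℕ) : Set (Herm (Fin n)) :=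
  {A | (A : Matrix (Fin n) (Fin n) ℂ).rank = 1 ∧ (A : Matrix (Fin n) (Fin n) ℂ).trace = 1}

/-- Product pure states `P ⊗ Q` with `P`, `Q` pure. -/
def productPure (m n : ℕ) : Set (Herm (Fin m × Fin n)) :=
  Set.image2 kron (pureStates m) (pureStates n)

/-- Separable states: the convex hull of the products of density matrices. -/
def separable (m n : ℕ) : Set (Herm (Fin m × Fin n)) :=
  convexHull ℝ (Set.image2 kron (density m) (density n))

/-- `ψ` is `A ↦ U A U*` or `A ↦ U Aᵀ U*`. -/
def IsUnitaryForm {n : ℕ} (U : Matrix (Fin n) (Fin n) ℂ)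
    (ψ : Herm (Fin n) → Herm (Fin n)) : Prop :=
  (∀ A : Herm (Fin n), (ψ A : Matrix (Fin n) (Fin n) ℂ) =
      U * (A : Matrix (Fin n) (Fin n) ℂ) * U.conjTranspose) ∨
  (∀ A : Herm (Fin n), (ψ A : Matrix (Fin n) (Fin n) ℂ) =
      U * (A : Matrix (Fin n) (Fin n) ℂ).transpose * U.conjTranspose)

/-- Transport of a Hermitian matrix along an equality of orders (same entries). -/
def castHerm {m n : ℕ} (h : m = n) (A : Herm (Fin m)) : Herm (Fin n) := h ▸ A

end SepStates

namespace SepStates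

open Matrix

/-! ### Hermitian matrices and the trace form -/

section Herm

variable {ι : Type} [Fintype ι]

/-! Separable states form the convex hull of the product pure states. In the norm of the trace form
this hull lies in the unit ball, and the product pure states lie on the unit sphere, so strict
convexity makes them exactly the extreme points. Both sets span the space, so a linear map carrying
either onto itself is bijective. Hence preserving one is the same as preserving the other.

Suppose that `Ψ` preserves product pure states, and fix one tensor factor. The resulting linear map
sends pure states to product pure states, and by `ptrace_eq_or_eq` one factor of its values is
constant. Indeed, along `x + t y` the squared norm is a quadratic polynomial irreducible over the
reals which divides a product of two real quadratics, hence divides one of them. Thus `Ψ` permutes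
the grid of pairs of pure states and sends each row and each column into a row or a column. The
combinatorial `factor_or_swap` then gives that the factors are treated separately, up to an
exchange. An exchange forces `m = n` by dimension.

Each factor map is linear and maps the pure states onto themselves. An order argument
(`traceForm_le_traceForm_map`, applied to the map and to its inverse) shows that it preserves the
trace form. After a unitary conjugation it fixes the diagonal matrix units. Testing on rank one
matrices then shows that it is conjugation by a diagonal unitary, possibly after transposition
(`FixesDiagonal.uniform_phases`). -/

instance : Module.Finite ℝ (Herm ι) := by
  have : Module.Finite ℝ (Matrix ι ι ℂ) := Module.Finite.trans ℂ _
  exact Module.Finite.of_surjective (realPart (A := Matrix ι ι ℂ)) realPart_surjective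

theorem Herm.conjTranspose_eq {ι : Type} (A : Herm ι) : (A : Matrix ι ι ℂ)ᴴ = A :=
  selfAdjoint.mem_iff.1 A.2

theorem Herm.isHermitian {ι : Type} (A : Herm ι) : (A : Matrix ι ι ℂ).IsHermitian :=
  A.conjTranspose_eq

theorem Herm.star_apply {ι : Type} (A : Herm ι) (i j : ι) :
    star ((A : Matrix ι ι ℂ) i j) = (A : Matrix ι ι ℂ) j i :=
  A.isHermitian.apply j i

/-- A matrix equal to its conjugate transpose, as an element of `Herm`. -/
def Herm.mk {ι : Type} (A : Matrix ι ι ℂ) (h : Aᴴ = A) : Herm ι := ⟨A, h⟩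

@[simp] theorem Herm.coe_mk {ι : Type} (A : Matrix ι ι ℂ) (h : Aᴴ = A) :
    (Herm.mk A h : Matrix ι ι ℂ) = A := rfl

/-- The real trace form `(A, B) ↦ Re tr (A B)` on Hermitian matrices. -/
noncomputable def traceForm (ι : Type) [Fintype ι] : LinearMap.BilinForm ℝ (Herm ι) :=
  LinearMap.mk₂ ℝ (fun A B => ((A : Matrix ι ι ℂ) * (B : Matrix ι ι ℂ)).trace.re)
    (fun A A' B => by simp [add_mul])
    (fun c A B => by simp)
    (fun A B B' => by simp [mul_add])
    (fun c A B => by simp)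

theorem traceForm_apply (A B : Herm ι) :
    traceForm ι A B = ((A : Matrix ι ι ℂ) * (B : Matrix ι ι ℂ)).trace.re := rfl

theorem traceForm_comm (A B : Herm ι) : traceForm ι A B = traceForm ι B A := by
  rw [traceForm_apply, traceForm_apply, Matrix.trace_mul_comm]

theorem trace_mul_eq_traceForm (A B : Herm ι) :
    ((A : Matrix ι ι ℂ) * (B : Matrix ι ι ℂ)).trace = (traceForm ι A B : ℂ) := by
  rw [traceForm_apply, eq_comm, ← Complex.conj_eq_iff_re]
  change star _ = _
  rw [← Matrix.trace_conjTranspose, Matrix.conjTranspose_mul, A.conjTranspose_eq,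
    B.conjTranspose_eq, Matrix.trace_mul_comm]

theorem traceForm_self (A : Herm ι) :
    traceForm ι A A = ∑ i, ∑ j, Complex.normSq ((A : Matrix ι ι ℂ) i j) := by
  rw [traceForm_apply, Matrix.trace]
  simp only [Matrix.diag_apply, Matrix.mul_apply, Complex.re_sum]
  refine Finset.sum_congr rfl fun i _ => Finset.sum_congr rfl fun j _ => ?_
  rw [← A.star_apply i j]
  simp [Complex.normSq_apply]

theorem traceForm_self_nonneg (A : Herm ι) : 0 ≤ traceForm ι A A := by
  rw [traceForm_self]
  exact Finset.sum_nonneg fun i _ => Finset.sum_nonneg fun j _ => Complex.normSq_nonneg _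

theorem traceForm_self_eq_zero {A : Herm ι} : traceForm ι A A = 0 ↔ A = 0 := by
  constructor
  · intro h
    rw [traceForm_self] at h
    ext i j
    have h' := (Finset.sum_eq_zero_iff_of_nonneg
      (fun i _ => Finset.sum_nonneg fun j _ => Complex.normSq_nonneg _)).1 h i (Finset.mem_univ _)
    exact Complex.normSq_eq_zero.1 ((Finset.sum_eq_zero_iff_of_nonneg
      (fun j _ => Complex.normSq_nonneg _)).1 h' j (Finset.mem_univ _))
  · rintro rfl
    simp

theorem traceForm_nondegenerate : (traceForm ι).Nondegenerate := by
  constructor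
  · intro A h
    exact traceForm_self_eq_zero.1 (h A)
  · intro A h
    exact traceForm_self_eq_zero.1 (h A)

/-- Every real functional on Hermitian matrices is given by the trace form. -/
theorem exists_traceForm_eq (l : Herm ι →ₗ[ℝ] ℝ) : ∃ X : Herm ι, ∀ A, traceForm ι X A = l A := by
  refine ⟨((traceForm ι).toDual traceForm_nondegenerate).symm l, fun A => ?_⟩
  exact LinearMap.BilinForm.apply_toDual_symm_apply ..

/-- The Hermitian matrix `x x*`. -/
def rankOne {ι : Type} (x : ι → ℂ) : Herm ι :=
  Herm.mk (vecMulVec x (star x)) (by rw [conjTranspose_vecMulVec, star_star])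

theorem rankOne_apply {ι : Type} (x : ι → ℂ) (i j : ι) :
    (rankOne x : Matrix ι ι ℂ) i j = x i * star (x j) := rfl

theorem trace_rankOne (x : ι → ℂ) : (rankOne x : Matrix ι ι ℂ).trace = star x ⬝ᵥ x := by
  rw [dotProduct_comm]
  exact trace_vecMulVec x (star x)

theorem trace_mul_rankOne (A : Matrix ι ι ℂ) (x : ι → ℂ) :
    (A * (rankOne x : Matrix ι ι ℂ)).trace = star x ⬝ᵥ (A *ᵥ x) := by
  change (A * vecMulVec x (star x)).trace = _
  rw [Matrix.mul_vecMulVec, trace_vecMulVec, dotProduct_comm]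

theorem traceForm_rankOne (A : Herm ι) (x : ι → ℂ) :
    traceForm ι A (rankOne x) = (star x ⬝ᵥ ((A : Matrix ι ι ℂ) *ᵥ x)).re := by
  rw [traceForm_apply, trace_mul_rankOne]

theorem rankOne_smul {ι : Type} (c : ℂ) (x : ι → ℂ) :
    rankOne (c • x) = Complex.normSq c • rankOne x := by
  ext i j
  change (c • x) i * star ((c • x) j) = (Complex.normSq c : ℝ) • (x i * star (x j))
  rw [Complex.real_smul, Complex.normSq_eq_conj_mul_self]
  simp
  ring

theorem star_dotProduct_self (x : ι → ℂ) :
    star x ⬝ᵥ x = ((∑ i, Complex.normSq (x i) : ℝ) : ℂ) := by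
  simp [dotProduct, Complex.normSq_eq_conj_mul_self]

end Herm

/-! ### Spectral decomposition and pure states as unit vectors -/

section Pure

variable {n : ℕ}

theorem Herm.exists_spectral (A : Herm (Fin n)) :
    ∃ u : Fin n → Fin n → ℂ, (∀ i, star (u i) ⬝ᵥ u i = 1) ∧
      A = ∑ i, A.isHermitian.eigenvalues i • rankOne (u i) := by
  refine ⟨fun i => A.isHermitian.eigenvectorBasis i, fun i => ?_, ?_⟩
  · have h := A.isHermitian.eigenvectorBasis.orthonormal.1 i
    have h2 := inner_self_eq_norm_sq_to_K (𝕜 := ℂ) (A.isHermitian.eigenvectorBasis i)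
    rw [h, EuclideanSpace.inner_eq_star_dotProduct, dotProduct_comm] at h2
    simpa using h2
  · ext a b
    have h := congrFun (congrFun A.isHermitian.spectral_theorem a) b
    rw [Unitary.conjStarAlgAut_apply, Matrix.mul_apply] at h
    rw [h]
    rw [AddSubgroup.val_finsetSum, Matrix.sum_apply]
    refine Finset.sum_congr rfl fun i _ => ?_
    rw [Matrix.mul_diagonal]
    change _ = A.isHermitian.eigenvalues i • ((_ : ℂ) * (_ : ℂ))
    rw [Complex.real_smul, Matrix.star_apply,
      Matrix.IsHermitian.eigenvectorUnitary_apply, Matrix.IsHermitian.eigenvectorUnitary_apply]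
    simp
    ring

theorem mem_pureStates_iff {A : Herm (Fin n)} :
    A ∈ pureStates n ↔ ∃ x : Fin n → ℂ, star x ⬝ᵥ x = 1 ∧ A = rankOne x := by
  constructor
  · rintro ⟨hr, ht⟩
    obtain ⟨u, hu, hA⟩ := A.exists_spectral
    rw [A.isHermitian.rank_eq_card_non_zero_eigs, Fintype.card_eq_one_iff] at hr
    obtain ⟨⟨i, hi⟩, huniq⟩ := hr
    have hz : ∀ j, j ≠ i → A.isHermitian.eigenvalues j = 0 := by
      intro j hj
      by_contra h
      exact hj (congrArg Subtype.val (huniq ⟨j, h⟩))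
    rw [A.isHermitian.trace_eq_sum_eigenvalues, Finset.sum_eq_single i
      (fun j _ hj => by simp [hz j hj]) (by simp)] at ht
    have ht' : A.isHermitian.eigenvalues i = 1 := Complex.ofReal_eq_one.1 ht
    refine ⟨u i, hu i, hA.trans ?_⟩
    rw [Finset.sum_eq_single i (fun j _ hj => by simp [hz j hj]) (by simp), ht', one_smul]
  · rintro ⟨x, hx, rfl⟩
    have ht : (rankOne x : Matrix (Fin n) (Fin n) ℂ).trace = 1 := by rw [trace_rankOne, hx]
    refine ⟨le_antisymm (rank_vecMulVec_le x (star x)) (Nat.one_le_iff_ne_zero.2 fun h => ?_), ht⟩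
    rw [(rankOne x).isHermitian.rank_eq_card_non_zero_eigs, Fintype.card_eq_zero_iff] at h
    rw [(rankOne x).isHermitian.trace_eq_sum_eigenvalues, Finset.sum_eq_zero] at ht
    · exact zero_ne_one ht
    · intro i _
      by_contra hi
      exact h.false ⟨i, fun h' => hi (by simp [h'])⟩

theorem rankOne_mem_pureStates {x : Fin n → ℂ} (hx : star x ⬝ᵥ x = 1) :
    rankOne x ∈ pureStates n := mem_pureStates_iff.2 ⟨x, hx, rfl⟩

theorem span_pureStates : Submodule.span ℝ (pureStates n) = ⊤ := by
  rw [eq_top_iff]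
  intro A _
  obtain ⟨u, hu, hA⟩ := A.exists_spectral
  rw [hA]
  exact Submodule.sum_mem _ fun i _ => Submodule.smul_mem _ _
    (Submodule.subset_span (rankOne_mem_pureStates (hu i)))

theorem rankOne_eq_smul_pure {x : Fin n → ℂ} {t : ℝ} (ht : 0 < t) (hx : star x ⬝ᵥ x = (t : ℂ)) :
    ∃ P ∈ pureStates n, rankOne x = t • P := by
  have hs : (Real.sqrt t) ^ 2 = t := Real.sq_sqrt ht.le
  have hs0 : Real.sqrt t ≠ 0 := (Real.sqrt_pos.2 ht).ne'
  refine ⟨t⁻¹ • rankOne x, ?_, by rw [smul_smul, mul_inv_cancel₀ ht.ne', one_smul]⟩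
  rw [mem_pureStates_iff]
  refine ⟨((Real.sqrt t)⁻¹ : ℂ) • x, ?_, ?_⟩
  · rw [star_smul, smul_dotProduct, dotProduct_smul, hx, smul_smul]
    rw [← Complex.ofReal_inv, Complex.star_def, Complex.conj_ofReal, smul_eq_mul]
    norm_cast
    rw [← hs]
    field_simp
    simp [hs]
  · rw [rankOne_smul]
    congr 1
    rw [← Complex.ofReal_inv, Complex.normSq_ofReal, ← mul_inv, ← sq, hs]

end Pure

/-! ### Kronecker products and partial traces -/

section Kron

variable {m n : ℕ}

@[simp] theorem coe_kron (A : Herm (Fin m)) (B : Herm (Fin n)) :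
    (kron A B : Matrix (Fin m × Fin n) (Fin m × Fin n) ℂ) =
      (A : Matrix (Fin m) (Fin m) ℂ) ⊗ₖ (B : Matrix (Fin n) (Fin n) ℂ) := rfl

/-- The Kronecker product as a real bilinear map. -/
noncomputable def kronₗ (m n : ℕ) : Herm (Fin m) →ₗ[ℝ] Herm (Fin n) →ₗ[ℝ] Herm (Fin m × Fin n) :=
  LinearMap.mk₂ ℝ kron
    (fun A A' B => Subtype.ext (by simp [Matrix.add_kronecker]))
    (fun c A B => Subtype.ext (by simp [Matrix.smul_kronecker]))
    (fun A B B' => Subtype.ext (by simp [Matrix.kronecker_add]))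
    (fun c A B => Subtype.ext (by simp [Matrix.kronecker_smul]))

@[simp] theorem kronₗ_apply (A : Herm (Fin m)) (B : Herm (Fin n)) : kronₗ m n A B = kron A B := rfl

theorem traceForm_kron (A C : Herm (Fin m)) (B D : Herm (Fin n)) :
    traceForm _ (kron A B) (kron C D) = traceForm _ A C * traceForm _ B D := by
  rw [traceForm_apply, coe_kron, coe_kron, ← Matrix.mul_kronecker_mul, Matrix.trace_kronecker,
    trace_mul_eq_traceForm, trace_mul_eq_traceForm, ← Complex.ofReal_mul, Complex.ofReal_re]

/-- The partial trace over the second factor. -/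
noncomputable def ptraceRight (m n : ℕ) : Herm (Fin m × Fin n) →ₗ[ℝ] Herm (Fin m) where
  toFun X := Herm.mk (Matrix.of fun i j => ∑ k, X.1 (i, k) (j, k)) (by
    ext i j
    simp only [Matrix.conjTranspose_apply, Matrix.of_apply, star_sum, Herm.star_apply])
  map_add' X Y := by
    ext i j
    simp [Finset.sum_add_distrib]
  map_smul' c X := by
    ext i j
    simp [Finset.mul_sum]

/-- The partial trace over the first factor. -/
noncomputable def ptraceLeft (m n : ℕ) : Herm (Fin m × Fin n) →ₗ[ℝ] Herm (Fin n) where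
  toFun X := Herm.mk (Matrix.of fun i j => ∑ k, X.1 (k, i) (k, j)) (by
    ext i j
    simp only [Matrix.conjTranspose_apply, Matrix.of_apply, star_sum, Herm.star_apply])
  map_add' X Y := by
    ext i j
    simp [Finset.sum_add_distrib]
  map_smul' c X := by
    ext i j
    simp [Finset.mul_sum]

theorem ptraceRight_kron (A : Herm (Fin m)) {B : Herm (Fin n)}
    (hB : (B : Matrix (Fin n) (Fin n) ℂ).trace = 1) : ptraceRight m n (kron A B) = A := by
  ext i j
  change ∑ k, A.1 i j * B.1 k k = A.1 i j
  rw [← Finset.mul_sum]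
  exact (congrArg _ hB).trans (mul_one _)

theorem ptraceLeft_kron {A : Herm (Fin m)} (B : Herm (Fin n))
    (hA : (A : Matrix (Fin m) (Fin m) ℂ).trace = 1) : ptraceLeft m n (kron A B) = B := by
  ext i j
  change ∑ k, A.1 k k * B.1 i j = B.1 i j
  rw [← Finset.sum_mul]
  exact (congrArg (· * _) hA).trans (one_mul _)

/-- Since the factors have trace one, the partial traces recover them; they serve as coordinates on
the product pure states. -/
theorem mem_productPure_iff {X : Herm (Fin m × Fin n)} :
    X ∈ productPure m n ↔ ptraceRight m n X ∈ pureStates m ∧ ptraceLeft m n X ∈ pureStates n ∧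
      kron (ptraceRight m n X) (ptraceLeft m n X) = X := by
  constructor
  · rintro ⟨P, hP, Q, hQ, rfl⟩
    rw [ptraceRight_kron P hQ.2, ptraceLeft_kron Q hP.2]
    exact ⟨hP, hQ, rfl⟩
  · rintro ⟨hP, hQ, h⟩
    exact ⟨_, hP, _, hQ, h⟩

theorem kron_mem_productPure {P : Herm (Fin m)} {Q : Herm (Fin n)} (hP : P ∈ pureStates m)
    (hQ : Q ∈ pureStates n) : kron P Q ∈ productPure m n := ⟨P, hP, Q, hQ, rfl⟩

theorem kron_mem_span (A : Herm (Fin m)) (B : Herm (Fin n)) :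
    kron A B ∈ Submodule.span ℝ (productPure m n) := by
  have h1 : ∀ P ∈ pureStates m, ∀ B : Herm (Fin n),
      kron P B ∈ Submodule.span ℝ (productPure m n) := by
    intro P hP B
    have hB : B ∈ Submodule.span ℝ (pureStates n) := by rw [span_pureStates]; trivial
    have : Submodule.span ℝ (pureStates n) ≤
        (Submodule.span ℝ (productPure m n)).comap (kronₗ m n P) :=
      Submodule.span_le.2 fun Q hQ => Submodule.subset_span (kron_mem_productPure hP hQ)
    exact this hB
  have hA : A ∈ Submodule.span ℝ (pureStates m) := by rw [span_pureStates]; trivial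
  have : Submodule.span ℝ (pureStates m) ≤
      (Submodule.span ℝ (productPure m n)).comap ((kronₗ m n).flip B) :=
    Submodule.span_le.2 fun P hP => h1 P hP B
  exact this hA

/-- Splitting `A` and `B` into real and imaginary parts leaves four terms, each a complex scalar
times a Kronecker product of Hermitian matrices. The real part of such a term is a real multiple of
that product. -/
theorem realPart_smul_kronecker_mem_span (z : ℂ) (A : Matrix (Fin m) (Fin m) ℂ)
    (B : Matrix (Fin n) (Fin n) ℂ) :
    realPart (z • (A ⊗ₖ B)) ∈ Submodule.span ℝ (productPure m n) := by
  have key : ∀ (w : ℂ) (H : Herm (Fin m)) (K : Herm (Fin n)),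
      realPart (w • ((H : Matrix _ _ ℂ) ⊗ₖ (K : Matrix _ _ ℂ))) ∈
        Submodule.span ℝ (productPure m n) := by
    intro w H K
    rw [← coe_kron, realPart_smul, selfAdjoint.realPart_coe, selfAdjoint.imaginaryPart_coe,
      smul_zero, sub_zero]
    exact Submodule.smul_mem _ _ (kron_mem_span H K)
  have hA := realPart_add_I_smul_imaginaryPart A
  have hB := realPart_add_I_smul_imaginaryPart B
  rw [← hA, ← hB]
  simp only [Matrix.add_kronecker, Matrix.kronecker_add, Matrix.smul_kronecker,
    Matrix.kronecker_smul, smul_add, smul_smul, map_add]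
  exact add_mem (add_mem (key _ _ _) (key _ _ _)) (add_mem (key _ _ _) (key _ _ _))

theorem span_productPure : Submodule.span ℝ (productPure m n) = ⊤ := by
  rw [eq_top_iff]
  intro X _
  rw [← selfAdjoint.realPart_coe (x := X), Matrix.matrix_eq_sum_single X.1,
    map_sum]
  refine Submodule.sum_mem _ fun p _ => ?_
  rw [map_sum]
  refine Submodule.sum_mem _ fun q _ => ?_
  have : Matrix.single p q ((X : Matrix (Fin m × Fin n) (Fin m × Fin n) ℂ) p q) =
      (X : Matrix (Fin m × Fin n) (Fin m × Fin n) ℂ) p q •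
        (Matrix.single p.1 q.1 (1 : ℂ) ⊗ₖ Matrix.single p.2 q.2 (1 : ℂ)) := by
    rw [Matrix.single_kronecker_single, Matrix.smul_single]
    simp
  rw [this]
  exact realPart_smul_kronecker_mem_span _ _ _

theorem bijective_of_image_span {E : Type*} [AddCommGroup E] [Module ℝ E] [Module.Finite ℝ E]
    {s : Set E} (hs : Submodule.span ℝ s = ⊤) {f : E →ₗ[ℝ] E} (h : f '' s = s) :
    Function.Bijective f := by
  have hsurj : Function.Surjective f := by
    rw [← LinearMap.range_eq_top, LinearMap.range_eq_map, ← hs, Submodule.map_span, h]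
  exact ⟨LinearMap.injective_iff_surjective.2 hsurj, hsurj⟩

end Kron

/-! ### Separable states and their extreme points -/

section Convex

variable {m n : ℕ}

theorem density_subset_convexHull : density n ⊆ convexHull ℝ (pureStates n) := by
  rintro A ⟨hA, ht⟩
  obtain ⟨u, hu, hs⟩ := A.exists_spectral
  rw [A.isHermitian.trace_eq_sum_eigenvalues] at ht
  rw [hs]
  refine (convex_convexHull ℝ _).sum_mem (fun i _ => hA.eigenvalues_nonneg i) ?_
    fun i _ => subset_convexHull ℝ _ (rankOne_mem_pureStates (hu i))
  exact Complex.ofReal_injective ((Complex.ofReal_sum _ _).trans ht)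

theorem pureStates_subset_density : pureStates n ⊆ density n := by
  intro A hA
  obtain ⟨x, hx, rfl⟩ := mem_pureStates_iff.1 hA
  exact ⟨Matrix.posSemidef_vecMulVec_self_star x, hA.2⟩

theorem separable_eq_convexHull : separable m n = convexHull ℝ (productPure m n) := by
  apply Set.Subset.antisymm
  · refine convexHull_min ?_ (convex_convexHull ℝ _)
    rintro _ ⟨A, hA, B, hB, rfl⟩
    have h1 : ∀ P ∈ pureStates m, kron P B ∈ convexHull ℝ (productPure m n) := fun P hP =>
      convexHull_min (t := kronₗ m n P ⁻¹' convexHull ℝ (productPure m n))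
        (fun Q hQ => subset_convexHull ℝ _ (kron_mem_productPure hP hQ))
        ((convex_convexHull ℝ _).linear_preimage _) (density_subset_convexHull hB)
    exact convexHull_min (t := (kronₗ m n).flip B ⁻¹' convexHull ℝ (productPure m n))
        (fun P hP => h1 P hP)
        ((convex_convexHull ℝ _).linear_preimage _) (density_subset_convexHull hA)
  · exact convexHull_mono (Set.image2_subset pureStates_subset_density pureStates_subset_density)

theorem span_separable : Submodule.span ℝ (separable m n) = ⊤ := by
  rw [eq_top_iff, ← span_productPure, separable_eq_convexHull]
  exact Submodule.span_mono (subset_convexHull ℝ _)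

theorem traceForm_pure_self {P : Herm (Fin n)} (hP : P ∈ pureStates n) :
    traceForm _ P P = 1 := by
  obtain ⟨x, hx, rfl⟩ := mem_pureStates_iff.1 hP
  rw [traceForm_rankOne]
  change (star x ⬝ᵥ (vecMulVec x (star x) *ᵥ x)).re = 1
  rw [vecMulVec_mulVec, hx]
  simp [hx]

/-- The last term measures strict convexity: its sign keeps convex combinations in the unit ball,
and its vanishing on the unit sphere forces `A = B`. -/
theorem traceForm_convex_combination {ι : Type} [Fintype ι] (A B : Herm ι) {a b : ℝ}
    (hab : a + b = 1) :
    traceForm ι (a • A + b • B) (a • A + b • B) =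
      a * traceForm ι A A + b * traceForm ι B B - a * b * traceForm ι (A - B) (A - B) := by
  obtain rfl : b = 1 - a := by linarith
  simp only [map_add, map_sub, map_smul, LinearMap.add_apply, LinearMap.sub_apply,
    LinearMap.smul_apply, smul_eq_mul, traceForm_comm B A]
  ring

theorem traceForm_separable_le {A : Herm (Fin m × Fin n)} (hA : A ∈ separable m n) :
    traceForm _ A A ≤ 1 := by
  rw [separable_eq_convexHull] at hA
  refine convexHull_min (t := {A | traceForm _ A A ≤ 1}) ?_ ?_ hA
  · rintro _ ⟨P, hP, Q, hQ, rfl⟩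
    simp [traceForm_kron, traceForm_pure_self hP, traceForm_pure_self hQ]
  · intro A hA B hB a b ha hb hab
    simp only [Set.mem_ofPred_eq] at *
    rw [traceForm_convex_combination A B hab]
    have := mul_nonneg (mul_nonneg ha hb) (traceForm_self_nonneg (A - B))
    nlinarith

theorem extremePoints_separable : (separable m n).extremePoints ℝ = productPure m n := by
  apply Set.Subset.antisymm
  · rw [separable_eq_convexHull]
    exact extremePoints_convexHull_subset
  · intro X hX
    rw [mem_extremePoints_iff_left]
    refine ⟨by rw [separable_eq_convexHull]; exact subset_convexHull ℝ _ hX, ?_⟩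
    rintro A hA B hB ⟨a, b, ha, hb, hab, rfl⟩
    have h1 : traceForm _ (a • A + b • B) (a • A + b • B) = 1 := by
      obtain ⟨P, hP, Q, hQ, h⟩ := hX
      rw [← h, traceForm_kron, traceForm_pure_self hP, traceForm_pure_self hQ, one_mul]
    rw [traceForm_convex_combination A B hab] at h1
    have hA1 := traceForm_separable_le hA
    have hB1 := traceForm_separable_le hB
    have h0 : a * b * traceForm _ (A - B) (A - B) ≤ 0 := by nlinarith
    have h2 : traceForm _ (A - B) (A - B) = 0 :=
      le_antisymm (nonpos_of_mul_nonpos_right h0 (mul_pos ha hb)) (traceForm_self_nonneg _)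
    have h3 : A = B := sub_eq_zero.1 (traceForm_self_eq_zero.1 h2)
    rw [← h3, ← add_smul, hab, one_smul]

theorem image_separable_iff (Ψ : Herm (Fin m × Fin n) →ₗ[ℝ] Herm (Fin m × Fin n)) :
    Ψ '' separable m n = separable m n ↔ Ψ '' productPure m n = productPure m n := by
  constructor
  · intro h
    have hb := bijective_of_image_span span_separable h
    have := image_extremePoints (𝕜 := ℝ) (LinearEquiv.ofBijective Ψ hb) (separable m n)
    rw [extremePoints_separable] at this
    change Ψ '' productPure m n = (Ψ '' separable m n).extremePoints ℝ at this
    rwa [h, extremePoints_separable] at this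
  · intro h
    rw [separable_eq_convexHull, LinearMap.image_convexHull, h]

end Convex

/-! ### Linear maps sending pure states to product pure states -/

section Dichotomy

/-- For `r ^ 2 < 1` the polynomial `1 + 2 r t + t ^ 2` is irreducible over the reals, so it divides
one of the two factors on the right. That factor is then a scalar multiple of it and has equal outer
coefficients. The proof carries this out on coefficients. -/
theorem eq_or_eq_of_mul_identity {r a b c a' b' c' B : ℝ} (hr : r ^ 2 < 1)
    (h : ∀ t : ℝ, (1 + 2 * r * t + t ^ 2) * (a * a' + t * B + t ^ 2 * (c * c')) =
      (a + t * b + t ^ 2 * c) * (a' + t * b' + t ^ 2 * c')) : a = c ∨ a' = c' := by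
  -- The coefficients of degree 0 and 4 agree identically, so three values of `t` suffice to compare
  -- those of degree 1, 2 and 3.
  have h1 := h 1
  have h2 := h (-1)
  have h3 := h 2
  have c1 : a * b' + b * a' = B + 2 * r * (a * a') := by
    linear_combination (-1) * h1 + (1 / 3) * h2 + (1 / 6) * h3
  have c2 : a * c' + b * b' + c * a' = a * a' + c * c' + 2 * r * B := by
    linear_combination (-1 / 2) * h1 + (-1 / 2) * h2
  have c3 : b * c' + c * b' = B + 2 * r * (c * c') := by
    linear_combination (1 / 2) * h1 + (1 / 6) * h2 + (-1 / 6) * h3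
  by_contra! hne
  obtain ⟨hp, hq⟩ := hne
  -- The quantities `b - r (a + c)` and `b' - r (a' + c')` vanish together with `a - c` and `a' -
  -- c'` exactly for multiples of the irreducible quadratic. Eliminating the primed one between `e1`
  -- and `e2` leaves a sum of squares times `a' - c'`.
  have e1 : (a - c) * (b' - r * (a' + c')) + (b - r * (a + c)) * (a' - c') = 0 := by
    linear_combination c1 - c3
  have e2 : (b - r * (a + c)) * (b' - r * (a' + c')) = (1 - r ^ 2) * ((a - c) * (a' - c')) := by
    linear_combination c2 - r * c1 - r * c3
  have e3 : (a' - c') * ((b - r * (a + c)) ^ 2 + (1 - r ^ 2) * (a - c) ^ 2) = 0 := by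
    linear_combination (b - r * (a + c)) * e1 - (a - c) * e2
  have hpos : 0 < (b - r * (a + c)) ^ 2 + (1 - r ^ 2) * (a - c) ^ 2 := by
    have : 0 < (a - c) ^ 2 := by
      have := sub_ne_zero.2 hp
      positivity
    have h1r : 0 < 1 - r ^ 2 := by linarith
    positivity
  rcases mul_eq_zero.1 e3 with h0 | h0
  · exact hq (sub_eq_zero.1 h0)
  · exact hpos.ne' h0

theorem star_dotProduct_add_smul {ι : Type} [Fintype ι] {x y : ι → ℂ} (hx : star x ⬝ᵥ x = 1)
    (hy : star y ⬝ᵥ y = 1) (t : ℝ) :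
    star (x + (t : ℂ) • y) ⬝ᵥ (x + (t : ℂ) • y) =
      ((1 + 2 * (star x ⬝ᵥ y).re * t + t ^ 2 : ℝ) : ℂ) := by
  have hyx : star y ⬝ᵥ x = star (star x ⬝ᵥ y) := star_dotProduct y x
  simp only [star_add, star_smul, add_dotProduct, dotProduct_add, smul_dotProduct,
    dotProduct_smul, hx, hy, hyx, smul_eq_mul]
  apply Complex.ext
  · simp [sq]
    ring
  · simp [sq]

/-- The coefficient of `t` is `x y* + y x*`, written by polarization so that every term is a rank
one Hermitian matrix to which a real-linear map applies. -/
theorem rankOne_add_smul {ι : Type} (x y : ι → ℂ) (t : ℝ) :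
    rankOne (x + (t : ℂ) • y) =
      rankOne x + t • (rankOne (x + y) - rankOne x - rankOne y) + t ^ 2 • rankOne y := by
  ext i j
  change (x i + t * y i) * star (x j + t * y j) = x i * star (x j) +
    t • ((x i + y i) * star (x j + y j) - x i * star (x j) - y i * star (y j)) +
      t ^ 2 • (y i * star (y j))
  simp only [Complex.real_smul, star_add, star_mul', Complex.star_def, Complex.conj_ofReal]
  push_cast
  ring

theorem sq_re_dotProduct_lt_one {ι : Type} [Fintype ι] {x y : ι → ℂ} (hx : star x ⬝ᵥ x = 1)
    (hy : star y ⬝ᵥ y = 1) (hne : rankOne x ≠ rankOne y) : (star x ⬝ᵥ y).re ^ 2 < 1 := by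
  have hyx : (star y ⬝ᵥ x).re = (star x ⬝ᵥ y).re := by
    have : star y ⬝ᵥ x = star (star x ⬝ᵥ y) := star_dotProduct y x
    rw [this]
    simp
  set r := (star x ⬝ᵥ y).re with hr
  -- The squared norm of `y - r x` is `1 - r ^ 2`; if it vanishes, `y` is a multiple of `x` by a
  -- sign and both give the same projection.
  have h := star_dotProduct_add_smul hy hx (-r)
  rw [hyx, star_dotProduct_self] at h
  have h' := Complex.ofReal_injective h
  have hnn : 0 ≤ ∑ i, Complex.normSq ((y + ((-r : ℝ) : ℂ) • x) i) :=
    Finset.sum_nonneg fun i _ => Complex.normSq_nonneg _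
  rcases (show r ^ 2 ≤ 1 by nlinarith).lt_or_eq with hlt | heq
  · exact hlt
  · exfalso
    have h0 : ∑ i, Complex.normSq ((y + ((-r : ℝ) : ℂ) • x) i) = 0 := by rw [h']; linarith
    have hyr : y = (r : ℂ) • x := by
      funext i
      have := Complex.normSq_eq_zero.1 ((Finset.sum_eq_zero_iff_of_nonneg
        (fun i _ => Complex.normSq_nonneg _)).1 h0 i (Finset.mem_univ _))
      simp only [Pi.add_apply, Pi.smul_apply, smul_eq_mul, Complex.ofReal_neg] at this ⊢
      linear_combination this
    apply hne
    rw [hyr, rankOne_smul, Complex.normSq_ofReal, ← sq, heq, one_smul]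

theorem ptrace_eq_or_eq {k m n : ℕ} (L : Herm (Fin k) →ₗ[ℝ] Herm (Fin m × Fin n))
    (hL : ∀ P ∈ pureStates k, L P ∈ productPure m n) {P P' : Herm (Fin k)}
    (hP : P ∈ pureStates k) (hP' : P' ∈ pureStates k) :
    ptraceRight m n (L P) = ptraceRight m n (L P') ∨
      ptraceLeft m n (L P) = ptraceLeft m n (L P') := by
  by_contra! hne
  obtain ⟨hf, hg⟩ := hne
  have hPP : P ≠ P' := fun h => hf (by rw [h])
  obtain ⟨x, hx, rfl⟩ := mem_pureStates_iff.1 hP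
  obtain ⟨y, hy, rfl⟩ := mem_pureStates_iff.1 hP'
  have hr := sq_re_dotProduct_lt_one hx hy hPP
  set f := ptraceRight m n ∘ₗ L with hf'
  set g := ptraceLeft m n ∘ₗ L with hg'
  have hLk : ∀ R ∈ pureStates k, L R = kron (f R) (g R) := fun R hR =>
    (mem_productPure_iff.1 (hL R hR)).2.2.symm
  change f (rankOne x) ≠ f (rankOne y) at hf
  change g (rankOne x) ≠ g (rankOne y) at hg
  -- Pairing with `p` and `q` makes `a - c` and `a' - c'` equal to the squared norms of `p` and `q`,
  -- so equal outer coefficients mean `p = 0` or `q = 0`.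
  set p := f (rankOne x) - f (rankOne y) with hp
  set q := g (rankOne x) - g (rankOne y) with hq
  set S := rankOne (x + y) - rankOne x - rankOne y with hS
  have key := eq_or_eq_of_mul_identity (a := traceForm _ p (f (rankOne x)))
    (b := traceForm _ p (f S)) (c := traceForm _ p (f (rankOne y)))
    (a' := traceForm _ q (g (rankOne x)))
    (b' := traceForm _ q (g S)) (c' := traceForm _ q (g (rankOne y)))
    (B := traceForm _ (kron p q) (L S)) hr (fun t => by
      set N := 1 + 2 * (star x ⬝ᵥ y).re * t + t ^ 2 with hN
      have hNpos : 0 < N := by nlinarith [sq_nonneg ((star x ⬝ᵥ y).re + t)]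
      obtain ⟨R, hR, hxR⟩ := rankOne_eq_smul_pure hNpos (star_dotProduct_add_smul hx hy t)
      -- The product of `f` and `g` has degree two in its argument and `L` has degree one, which
      -- accounts for the extra factor `N`, the squared norm of `x + t y`.
      have h1 : N • L (rankOne (x + (t : ℂ) • y)) =
          kron (f (rankOne (x + (t : ℂ) • y))) (g (rankOne (x + (t : ℂ) • y))) := by
        rw [hxR, map_smul, hLk R hR, map_smul, map_smul, ← kronₗ_apply, ← kronₗ_apply, map_smul,
          map_smul, LinearMap.smul_apply]
      have h2 := congrArg (traceForm _ (kron p q)) h1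
      rw [traceForm_kron, rankOne_add_smul, ← hS] at h2
      simp only [map_add, map_smul, smul_eq_mul, hLk _ hP, hLk _ hP', traceForm_kron] at h2
      exact h2)
  rcases key with h | h
  · apply hf
    rw [← sub_eq_zero, ← traceForm_self_eq_zero, ← hp, hp, map_sub, ← hp, h, sub_self]
  · apply hg
    rw [← sub_eq_zero, ← traceForm_self_eq_zero, ← hq, hq, map_sub, ← hq, h, sub_self]

end Dichotomy

/-! ### Bijections of a product that map lines into lines -/

section Lines

/-- Two equivalence relations that together cover all pairs cannot both be proper, just as a group
is not the union of two proper subgroups. -/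
theorem forall_eq_or_forall_eq {α β γ : Type*} {f : α → β} {g : α → γ}
    (h : ∀ a b, f a = f b ∨ g a = g b) : (∀ a b, f a = f b) ∨ ∀ a b, g a = g b := by
  by_contra! hne
  obtain ⟨⟨a, b, hab⟩, c, d, hcd⟩ := hne
  have hg : ∀ e, g e = g a := by
    intro e
    by_contra he
    exact hab (((h e a).resolve_right he).symm.trans ((h e b).resolve_right fun h' =>
      he (h'.trans ((h a b).resolve_left hab).symm)))
  exact hcd ((hg c).trans (hg d).symm)

/-- Rows cannot be of mixed type. If row `q` has constant `G` and row `q'` constant `F`, each column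
joins its two image points along the common `F`-value or the common `G`-value. Among three columns
two make the same choice, which contradicts injectivity. -/
theorem lines_uniform {X Y Z W : Type*} {F : X → Y → Z} {G : X → Y → W}
    (hinj : ∀ p q p' q', F p q = F p' q' → G p q = G p' q' → p = p')
    (hrow : ∀ q, (∀ p p', F p q = F p' q) ∨ ∀ p p', G p q = G p' q)
    (hcol : ∀ p, (∀ q q', F p q = F p q') ∨ ∀ q q', G p q = G p q')
    {a b c : X} (hab : a ≠ b) (hbc : b ≠ c) (hac : a ≠ c) :
    (∀ q p p', F p q = F p' q) ∨ ∀ q p p', G p q = G p' q := by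
  by_contra! hne
  obtain ⟨⟨q, p₁, p₂, hq⟩, q', p₃, p₄, hq'⟩ := hne
  have hG : ∀ p p', G p q = G p' q := (hrow q).resolve_left fun h => hq (h _ _)
  have hF : ∀ p p', F p q' = F p' q' := (hrow q').resolve_right fun h => hq' (h _ _)
  have hd : ∀ p, F p q = F a q' ∨ G p q' = G a q := fun p =>
    (hcol p).imp (fun h => (h q q').trans (hF _ _)) (fun h => (h q' q).trans (hG _ _))
  have h1 : ∀ p p', F p q = F a q' → F p' q = F a q' → p = p' := fun p p' h h' =>
    hinj p q p' q (h.trans h'.symm) (hG _ _)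
  have h2 : ∀ p p', G p q' = G a q → G p' q' = G a q → p = p' := fun p p' h h' =>
    hinj p q' p' q' (hF _ _) (h.trans h'.symm)
  rcases hd a with ha | ha <;> rcases hd b with hb | hb <;> rcases hd c with hc | hc
  · exact hab (h1 _ _ ha hb)
  · exact hab (h1 _ _ ha hb)
  · exact hac (h1 _ _ ha hc)
  · exact hbc (h2 _ _ hb hc)
  · exact hbc (h1 _ _ hb hc)
  · exact hac (h2 _ _ ha hc)
  · exact hab (h2 _ _ ha hb)
  · exact hab (h2 _ _ ha hb)

theorem factor_or_swap {X Y : Type*} {F : X → Y → X} {G : X → Y → Y}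
    (hinj : ∀ p q p' q', F p q = F p' q' → G p q = G p' q' → p = p' ∧ q = q')
    (hsurj : ∀ x y, ∃ p q, F p q = x ∧ G p q = y)
    (hrow : ∀ q, (∀ p p', F p q = F p' q) ∨ ∀ p p', G p q = G p' q)
    (hcol : ∀ p, (∀ q q', F p q = F p q') ∨ ∀ q q', G p q = G p q')
    (hX : Subsingleton X ∨ ∃ a b c : X, a ≠ b ∧ b ≠ c ∧ a ≠ c)
    (hY : Subsingleton Y ∨ ∃ a b c : Y, a ≠ b ∧ b ≠ c ∧ a ≠ c) :
    ((∀ p q q', F p q = F p q') ∧ ∀ q p p', G p q = G p' q) ∨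
      ((∀ q p p', F p q = F p' q) ∧ ∀ p q q', G p q = G p q') := by
  rcases hX with hX | ⟨a, b, c, hab, hbc, hac⟩
  · exact Or.inl ⟨fun p q q' => Subsingleton.elim _ _, fun q p p' => by rw [Subsingleton.elim p p']⟩
  rcases hY with hY | ⟨a', b', c', hab', hbc', hac'⟩
  · exact Or.inl ⟨fun p q q' => by rw [Subsingleton.elim q q'], fun q p p' => Subsingleton.elim _ _⟩
  have h1 := lines_uniform (fun p q p' q' h h' => (hinj p q p' q' h h').1) hrow hcol hab hbc hac
  have h2 := lines_uniform (F := fun q p => F p q) (G := fun q p => G p q)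
    (fun q p q' p' h h' => (hinj p q p' q' h h').2) hcol hrow hab' hbc' hac'
  rcases h1 with h1 | h1 <;> rcases h2 with h2 | h2
  -- If rows and columns both keep `F` constant, then `F` is constant, against surjectivity.
  · obtain ⟨p, q, hp, -⟩ := hsurj a a'
    obtain ⟨p', q', hp', -⟩ := hsurj b a'
    exact absurd (hp.symm.trans (((h1 q p p').trans (h2 p' q q')).trans hp')) hab
  · exact Or.inr ⟨h1, h2⟩
  · exact Or.inl ⟨h2, h1⟩
  · obtain ⟨p, q, -, hp⟩ := hsurj a a'
    obtain ⟨p', q', -, hp'⟩ := hsurj a b'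
    exact absurd (hp.symm.trans (((h1 q p p').trans (h2 p' q q')).trans hp')) hab'

theorem subsingleton_or_three_pureStates (n : ℕ) :
    Subsingleton (pureStates n) ∨ ∃ a b c : pureStates n, a ≠ b ∧ b ≠ c ∧ a ≠ c := by
  rcases Nat.lt_or_ge n 2 with hn | hn
  · left
    refine ⟨fun ⟨A, hA⟩ ⟨B, hB⟩ => Subtype.ext ?_⟩
    have h := hA.2.trans hB.2.symm
    ext i j
    interval_cases n
    · exact i.elim0
    · rw [Subsingleton.elim i 0, Subsingleton.elim j 0]
      simpa [Matrix.trace] using h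
  · right
    obtain ⟨k, rfl⟩ := Nat.exists_eq_add_of_le' hn
    have hpure : ∀ s t : ℝ, s ^ 2 + t ^ 2 = 1 →
        rankOne (Pi.single 0 (s : ℂ) + Pi.single 1 (t : ℂ)) ∈ pureStates (k + 2) := by
      intro s t hst
      apply rankOne_mem_pureStates
      rw [star_dotProduct_self]
      norm_cast
      rw [Fin.sum_univ_succ, Fin.sum_univ_succ, Finset.sum_eq_zero]
      · simp [Complex.normSq_ofReal]
        linarith
      · intro i _
        simp [Fin.ext_iff]
    have hval : ∀ s t : ℝ, (rankOne (Pi.single 0 (s : ℂ) + Pi.single 1 (t : ℂ)) :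
        Herm (Fin (k + 2))).1 0 0 = ((s ^ 2 : ℝ) : ℂ) := by
      intro s t
      rw [rankOne_apply]
      simp [sq]
    have hne : ∀ (s t s' t' : ℝ) (h : s ^ 2 + t ^ 2 = 1) (h' : s' ^ 2 + t' ^ 2 = 1),
        s ^ 2 ≠ s' ^ 2 → (⟨_, hpure s t h⟩ : pureStates (k + 2)) ≠ ⟨_, hpure s' t' h'⟩ := by
      intro s t s' t' h h' hs heq
      have h1 := congrArg (fun A : pureStates (k + 2) => A.1.1 0 0) heq
      simp only [hval] at h1
      exact hs (Complex.ofReal_injective h1)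
    have h₁ : (1 : ℝ) ^ 2 + 0 ^ 2 = 1 := by norm_num
    have h₂ : (0 : ℝ) ^ 2 + 1 ^ 2 = 1 := by norm_num
    have h₃ : (3 / 5 : ℝ) ^ 2 + (4 / 5) ^ 2 = 1 := by norm_num
    exact ⟨⟨_, hpure _ _ h₁⟩, ⟨_, hpure _ _ h₂⟩, ⟨_, hpure _ _ h₃⟩, hne _ _ _ _ h₁ h₂ (by norm_num),
      hne _ _ _ _ h₂ h₃ (by norm_num), hne _ _ _ _ h₁ h₃ (by norm_num)⟩

end Lines

/-! ### Linear maps preserving pure states -/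

section Wigner

variable {n : ℕ}

theorem traceForm_rankOne_rankOne {ι : Type} [Fintype ι] (x y : ι → ℂ) :
    traceForm ι (rankOne x) (rankOne y) = Complex.normSq (star x ⬝ᵥ y) := by
  rw [traceForm_rankOne]
  change (star y ⬝ᵥ (vecMulVec x (star x) *ᵥ y)).re = _
  rw [vecMulVec_mulVec, op_smul_eq_smul, dotProduct_smul, star_dotProduct y x]
  simp [Complex.normSq_apply]

theorem traceForm_pure_nonneg {P Q : Herm (Fin n)} (hP : P ∈ pureStates n)
    (hQ : Q ∈ pureStates n) : 0 ≤ traceForm _ P Q := by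
  obtain ⟨x, hx, rfl⟩ := mem_pureStates_iff.1 hP
  obtain ⟨y, hy, rfl⟩ := mem_pureStates_iff.1 hQ
  rw [traceForm_rankOne_rankOne]
  exact Complex.normSq_nonneg _

theorem traceForm_pure_le_one {P Q : Herm (Fin n)} (hP : P ∈ pureStates n)
    (hQ : Q ∈ pureStates n) : traceForm _ P Q ≤ 1 := by
  have h := traceForm_self_nonneg (P - Q)
  simp only [map_sub, LinearMap.sub_apply, traceForm_pure_self hP, traceForm_pure_self hQ,
    traceForm_comm Q P] at h
  linarith

theorem exists_rankOne_smul (x : Fin n → ℂ) :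
    x = 0 ∨ ∃ t : ℝ, 0 < t ∧ ∃ P ∈ pureStates n, rankOne x = t • P := by
  by_cases hx : x = 0
  · exact Or.inl hx
  · right
    have hnn : 0 ≤ ∑ i, Complex.normSq (x i) :=
      Finset.sum_nonneg fun i _ => Complex.normSq_nonneg _
    have hpos : 0 < ∑ i, Complex.normSq (x i) := by
      refine hnn.lt_of_ne' fun h0 => hx ?_
      funext i
      exact Complex.normSq_eq_zero.1 ((Finset.sum_eq_zero_iff_of_nonneg
        (fun i _ => Complex.normSq_nonneg _)).1 h0 i (Finset.mem_univ _))
    exact ⟨_, hpos, rankOne_eq_smul_pure hpos (star_dotProduct_self x)⟩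

theorem rankOne_zero {ι : Type} : rankOne (0 : ι → ℂ) = 0 := by
  ext i j
  simp [rankOne_apply]

theorem posSemidef_of_traceForm_nonneg {X : Herm (Fin n)}
    (h : ∀ P ∈ pureStates n, 0 ≤ traceForm _ X P) : X.1.PosSemidef := by
  refine PosSemidef.of_dotProduct_mulVec_nonneg X.isHermitian fun x => ?_
  rw [← trace_mul_rankOne, trace_mul_eq_traceForm, Complex.zero_le_real]
  rcases exists_rankOne_smul x with rfl | ⟨t, ht, P, hP, hx⟩
  · rw [rankOne_zero, map_zero]
  · rw [hx, map_smul]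
    exact mul_nonneg ht.le (h P hP)

/-- Among the functionals with values in `[0, 1]` on pure states and value `1` at `P`,
the one given by `P` itself is the smallest. -/
theorem traceForm_le_of_eq_one {X P Q : Herm (Fin n)}
    (h0 : ∀ R ∈ pureStates n, 0 ≤ traceForm _ X R) (h1 : ∀ R ∈ pureStates n, traceForm _ X R ≤ 1)
    (hP : P ∈ pureStates n) (hXP : traceForm _ X P = 1) (hQ : Q ∈ pureStates n) :
    traceForm _ P Q ≤ traceForm _ X Q := by
  have hone : ∀ R ∈ pureStates n, traceForm _ (1 : Herm (Fin n)) R = 1 := by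
    intro R hR
    rw [traceForm_apply]
    change ((1 : Matrix (Fin n) (Fin n) ℂ) * R.1).trace.re = 1
    rw [one_mul, hR.2, Complex.one_re]
  have hX := posSemidef_of_traceForm_nonneg h0
  have hY : (1 - X : Herm (Fin n)).1.PosSemidef := posSemidef_of_traceForm_nonneg fun R hR => by
    rw [map_sub, LinearMap.sub_apply, hone R hR]
    linarith [h1 R hR]
  obtain ⟨x, hx, rfl⟩ := mem_pureStates_iff.1 hP
  obtain ⟨y, hy, rfl⟩ := mem_pureStates_iff.1 hQ
  have hYx : (1 - X : Herm (Fin n)).1 *ᵥ x = 0 := by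
    rw [← hY.dotProduct_mulVec_zero_iff, ← trace_mul_rankOne, trace_mul_eq_traceForm, map_sub,
      LinearMap.sub_apply, hone _ hP, hXP, sub_self, Complex.ofReal_zero]
  have hXx : X.1 *ᵥ x = x := by
    have : (1 - X.1) *ᵥ x = 0 := hYx
    rw [sub_mulVec, one_mulVec, sub_eq_zero] at this
    exact this.symm
  have hxX : star x ᵥ* X.1 = star x := by
    have := congrArg star hXx
    rwa [star_mulVec, X.conjTranspose_eq] at this
  -- The vector is the component of `y` orthogonal to `x`. As `X x = x`, the quadratic form of `X`
  -- at `y` splits into its value there plus the overlap of `x` and `y`.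
  have hw := hX.dotProduct_mulVec_nonneg (y - (star x ⬝ᵥ y) • x)
  have hexp : star (y - (star x ⬝ᵥ y) • x) ⬝ᵥ X.1 *ᵥ (y - (star x ⬝ᵥ y) • x) =
      star y ⬝ᵥ X.1 *ᵥ y - (Complex.normSq (star x ⬝ᵥ y) : ℂ) := by
    rw [mulVec_sub, mulVec_smul, hXx, star_sub, star_smul, sub_dotProduct, dotProduct_sub,
      dotProduct_sub, smul_dotProduct, smul_dotProduct, dotProduct_smul, dotProduct_smul,
      dotProduct_mulVec (star x), hxX, hx, star_dotProduct y x,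
      Complex.normSq_eq_conj_mul_self]
    simp only [smul_eq_mul, Complex.star_def]
    ring
  rw [hexp, ← trace_mul_rankOne, trace_mul_eq_traceForm, ← Complex.ofReal_sub,
    Complex.zero_le_real] at hw
  rw [traceForm_rankOne_rankOne]
  linarith

/-- The functional `A ↦ traceForm (ψ P) (ψ A)` lies in `[0, 1]` on pure states and is `1` at `P`, so
`traceForm_le_of_eq_one` applies to it. -/
theorem traceForm_le_traceForm_map {ψ : Herm (Fin n) →ₗ[ℝ] Herm (Fin n)}
    (h : ∀ P ∈ pureStates n, ψ P ∈ pureStates n) {P Q : Herm (Fin n)} (hP : P ∈ pureStates n)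
    (hQ : Q ∈ pureStates n) : traceForm _ P Q ≤ traceForm _ (ψ P) (ψ Q) := by
  obtain ⟨X, hX⟩ := exists_traceForm_eq (traceForm _ (ψ P) ∘ₗ ψ)
  have hX' : ∀ A, traceForm _ X A = traceForm _ (ψ P) (ψ A) := hX
  rw [← hX']
  refine traceForm_le_of_eq_one (fun R hR => ?_) (fun R hR => ?_) hP ?_ hQ
  · rw [hX']
    exact traceForm_pure_nonneg (h P hP) (h R hR)
  · rw [hX']
    exact traceForm_pure_le_one (h P hP) (h R hR)
  · rw [hX', traceForm_pure_self (h P hP)]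

/-- The inequality for `ψ` and for its inverse gives equality on pure states; bilinearity and
spanning do the rest. -/
theorem traceForm_map_map {ψ : Herm (Fin n) →ₗ[ℝ] Herm (Fin n)}
    (h : ψ '' pureStates n = pureStates n) (A B : Herm (Fin n)) :
    traceForm _ (ψ A) (ψ B) = traceForm _ A B := by
  have hb := bijective_of_image_span span_pureStates h
  have hmap : ∀ P ∈ pureStates n, ψ P ∈ pureStates n := fun P hP => h ▸ Set.mem_image_of_mem ψ hP
  let e := LinearEquiv.ofBijective ψ hb
  have hsymm : ∀ P ∈ pureStates n, e.symm P ∈ pureStates n := by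
    intro P hP
    rw [← h] at hP
    obtain ⟨Q, hQ, rfl⟩ := hP
    exact (e.symm_apply_apply Q).symm ▸ hQ
  have hpure : ∀ P ∈ pureStates n, ∀ Q ∈ pureStates n,
      traceForm _ (ψ P) (ψ Q) = traceForm _ P Q := by
    intro P hP Q hQ
    refine le_antisymm ?_ (traceForm_le_traceForm_map hmap hP hQ)
    have := traceForm_le_traceForm_map (ψ := e.symm.toLinearMap) hsymm (hmap P hP) (hmap Q hQ)
    rwa [show e.symm.toLinearMap (ψ P) = P from e.symm_apply_apply P,
      show e.symm.toLinearMap (ψ Q) = Q from e.symm_apply_apply Q] at this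
  have h1 : ∀ P ∈ pureStates n, traceForm _ (ψ P) ∘ₗ ψ = traceForm _ P := fun P hP =>
    LinearMap.ext_on span_pureStates fun Q hQ => hpure P hP Q hQ
  have h2 : (traceForm _).flip (ψ B) ∘ₗ ψ = (traceForm _).flip B :=
    LinearMap.ext_on span_pureStates fun P hP => LinearMap.congr_fun (h1 P hP) B
  exact LinearMap.congr_fun h2 A

/-- Conjugation `A ↦ U A U*` of Hermitian matrices. -/
noncomputable def conjHerm (U : Matrix (Fin n) (Fin n) ℂ) : Herm (Fin n) →ₗ[ℝ] Herm (Fin n) where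
  toFun A := Herm.mk (U * A.1 * Uᴴ) (by
    rw [conjTranspose_mul, conjTranspose_mul, conjTranspose_conjTranspose, A.conjTranspose_eq,
      Matrix.mul_assoc])
  map_add' A B := Subtype.ext (by simp [mul_add, add_mul])
  map_smul' c A := Subtype.ext (by simp)

theorem coe_conjHerm (U : Matrix (Fin n) (Fin n) ℂ) (A : Herm (Fin n)) :
    (conjHerm U A).1 = U * A.1 * Uᴴ := rfl

theorem conjHerm_rankOne (U : Matrix (Fin n) (Fin n) ℂ) (x : Fin n → ℂ) :
    conjHerm U (rankOne x) = rankOne (U *ᵥ x) := by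
  apply Subtype.ext
  change U * vecMulVec x (star x) * Uᴴ = vecMulVec (U *ᵥ x) (star (U *ᵥ x))
  rw [mul_vecMulVec, vecMulVec_mul, star_mulVec]

theorem conjHerm_mem_pureStates {U : Matrix (Fin n) (Fin n) ℂ} (hU : Uᴴ * U = 1)
    {P : Herm (Fin n)} (hP : P ∈ pureStates n) : conjHerm U P ∈ pureStates n := by
  obtain ⟨x, hx, rfl⟩ := mem_pureStates_iff.1 hP
  rw [conjHerm_rankOne]
  apply rankOne_mem_pureStates
  rw [star_mulVec, ← dotProduct_mulVec, mulVec_mulVec, hU, one_mulVec, hx]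

theorem traceForm_conjHerm {U : Matrix (Fin n) (Fin n) ℂ} (hU : Uᴴ * U = 1)
    (A B : Herm (Fin n)) : traceForm _ (conjHerm U A) (conjHerm U B) = traceForm _ A B := by
  rw [traceForm_apply, traceForm_apply, coe_conjHerm, coe_conjHerm]
  have : U * A.1 * Uᴴ * (U * B.1 * Uᴴ) = U * (A.1 * B.1) * Uᴴ := by
    calc U * A.1 * Uᴴ * (U * B.1 * Uᴴ) = U * A.1 * (Uᴴ * U) * B.1 * Uᴴ := by
          simp only [Matrix.mul_assoc]
      _ = _ := by rw [hU, Matrix.mul_one, Matrix.mul_assoc U]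
  rw [this, Matrix.trace_mul_comm, ← Matrix.mul_assoc, hU, Matrix.one_mul]

theorem traceForm_rankOne_single (A : Herm (Fin n)) (i : Fin n) :
    traceForm _ A (rankOne (Pi.single i 1)) = (A.1 i i).re := by
  rw [traceForm_rankOne]
  simp

theorem traceForm_rankOne_pair (A : Herm (Fin n)) (i j : Fin n) (a b : ℂ) :
    traceForm _ A (rankOne (Pi.single i a + Pi.single j b)) =
      Complex.normSq a * (A.1 i i).re + Complex.normSq b * (A.1 j j).re +
        2 * (star a * b * A.1 i j).re := by
  have hji := A.star_apply i j
  have hii := A.star_apply i i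
  have hjj := A.star_apply j j
  rw [traceForm_rankOne]
  simp only [star_add, mulVec_add, add_dotProduct, dotProduct_add, ← Pi.single_star,
    single_dotProduct, mulVec_single, Pi.smul_apply, MulOpposite.smul_eq_mul_unop,
    MulOpposite.unop_op, col_apply]
  rw [← hji]
  have h1 := congrArg Complex.im hii
  have h2 := congrArg Complex.im hjj
  simp at h1 h2
  simp [Complex.normSq_apply]
  ring_nf

theorem eq_single_add_single {z : Fin n → ℂ} {i j : Fin n} (hij : i ≠ j)
    (h : ∀ k, k ≠ i → k ≠ j → z k = 0) : z = Pi.single i (z i) + Pi.single j (z j) := by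
  funext k
  by_cases hi : k = i
  · subst hi
    simp [hij]
  · by_cases hj : k = j
    · subst hj
      simp [hi]
    · simp [hi, hj, h k hi hj]

theorem star_mul_self_eq_one {z : ℂ} (h : Complex.normSq z = 1) : star z * z = 1 := by
  rw [Complex.star_def, ← Complex.normSq_eq_conj_mul_self, h, Complex.ofReal_one]

/-- A quarter turn: unimodular numbers with orthogonal directions. -/
theorem eq_I_mul_or_eq_neg_I_mul {p q : ℂ} (hp : Complex.normSq p = 1)
    (hq : Complex.normSq q = 1) (hpq : (p * star q).re = 0) :
    q = Complex.I * p ∨ q = -Complex.I * p := by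
  have hs : ((p * star q).im - 1) * ((p * star q).im + 1) = 0 := by
    have : Complex.normSq (p * star q) = 1 := by
      rw [Complex.normSq_mul, hp, Complex.star_def, Complex.normSq_conj, hq, one_mul]
    rw [Complex.normSq_apply, hpq] at this
    linarith
  have hpp := star_mul_self_eq_one hp
  have hq' : q = star (p * star q) * p := by
    rw [star_mul', star_star]
    linear_combination -q * hpp
  rcases mul_eq_zero.1 hs with h | h
  · right
    have : p * star q = Complex.I := Complex.ext hpq (sub_eq_zero.1 h)
    rw [hq', this]
    simp
  · left
    have : p * star q = -Complex.I := Complex.ext (by rw [hpq]; simp)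
      (by rw [Complex.neg_im, Complex.I_im]; linarith)
    rw [hq', this]
    simp

/-- A linear map preserving pure states, the trace form and the diagonal matrix units. -/
structure FixesDiagonal (ψ : Herm (Fin n) →ₗ[ℝ] Herm (Fin n)) : Prop where
  map_pure : ∀ P ∈ pureStates n, ψ P ∈ pureStates n
  traceForm_map : ∀ A B, traceForm _ (ψ A) (ψ B) = traceForm _ A B
  map_single : ∀ i, ψ (rankOne (Pi.single i 1)) = rankOne (Pi.single i 1)

namespace FixesDiagonal

variable {ψ : Herm (Fin n) →ₗ[ℝ] Herm (Fin n)}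

theorem map_diag (h : FixesDiagonal ψ) (A : Herm (Fin n)) (i : Fin n) :
    (ψ A).1 i i = A.1 i i := by
  have h1 := h.traceForm_map A (rankOne (Pi.single i 1))
  rw [h.map_single, traceForm_rankOne_single, traceForm_rankOne_single] at h1
  have hA := congrArg Complex.im (A.star_apply i i)
  have hB := congrArg Complex.im ((ψ A).star_apply i i)
  simp only [Complex.star_def, Complex.conj_im] at hA hB
  exact Complex.ext h1 (by linarith)

theorem exists_rankOne (h : FixesDiagonal ψ) (x : Fin n → ℂ) :
    ∃ z, ψ (rankOne x) = rankOne z ∧ ∀ i, Complex.normSq (z i) = Complex.normSq (x i) := by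
  have key : ∃ z, ψ (rankOne x) = rankOne z := by
    rcases exists_rankOne_smul x with rfl | ⟨t, ht, P, hP, hx⟩
    · exact ⟨0, by rw [rankOne_zero, map_zero]⟩
    · obtain ⟨z, -, hz⟩ := mem_pureStates_iff.1 (h.map_pure P hP)
      refine ⟨((Real.sqrt t : ℝ) : ℂ) • z, ?_⟩
      rw [hx, map_smul, hz, rankOne_smul, Complex.normSq_ofReal, Real.mul_self_sqrt ht.le]
  obtain ⟨z, hz⟩ := key
  refine ⟨z, hz, fun i => ?_⟩
  have hd := h.map_diag (rankOne x) i
  rw [hz, rankOne_apply, rankOne_apply, Complex.star_def, Complex.mul_conj,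
    Complex.mul_conj] at hd
  exact Complex.ofReal_injective hd

/-- Testing against `e_i + b e_j` for `b = 1` and `b = I` fixes the real and imaginary parts of the
entry `(i, j)` of `ψ A`, up to a phase. The sign of the quarter turn between the two images decides
between `A i j` and its conjugate `A j i`. -/
theorem map_apply_of_ne (h : FixesDiagonal ψ) {i j : Fin n} (hij : i ≠ j) :
    ∃ c : ℂ, (∀ A, (ψ A).1 i j = c * A.1 i j) ∨ ∀ A, (ψ A).1 i j = c * A.1 j i := by
  have hsupp : ∀ b : ℂ, Complex.normSq b = 1 → ∃ u v : ℂ, Complex.normSq u = 1 ∧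
      Complex.normSq v = 1 ∧ ψ (rankOne (Pi.single i 1 + Pi.single j b)) =
        rankOne (Pi.single i u + Pi.single j v) := by
    intro b hb
    obtain ⟨z, hz, hzn⟩ := h.exists_rankOne (Pi.single i 1 + Pi.single j b)
    refine ⟨z i, z j, ?_, ?_, ?_⟩
    · simp [hzn, hij]
    · simp [hzn, hij.symm, hb]
    · rw [hz, ← eq_single_add_single hij]
      intro k hi hj
      rw [← Complex.normSq_eq_zero, hzn]
      simp [hi, hj]
  have hre : ∀ b u v : ℂ, Complex.normSq b = 1 → Complex.normSq u = 1 →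
      Complex.normSq v = 1 → ψ (rankOne (Pi.single i 1 + Pi.single j b)) =
        rankOne (Pi.single i u + Pi.single j v) →
      ∀ A, (star u * v * (ψ A).1 i j).re = (b * A.1 i j).re := by
    intro b u v hb hu hv hψ A
    have h1 := h.traceForm_map A (rankOne (Pi.single i 1 + Pi.single j b))
    rw [hψ, traceForm_rankOne_pair, traceForm_rankOne_pair, hu, hv, hb, h.map_diag, h.map_diag,
      star_one, Complex.normSq_one, one_mul, one_mul, one_mul] at h1
    linarith
  obtain ⟨u, v, hu, hv, huv⟩ := hsupp 1 (by simp)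
  obtain ⟨u', v', hu', hv', huv'⟩ := hsupp Complex.I (by simp)
  have hr := hre 1 u v (by simp) hu hv huv
  have hr' := hre Complex.I u' v' (by simp) hu' hv' huv'
  have hnp : ∀ u v : ℂ, Complex.normSq u = 1 → Complex.normSq v = 1 →
      Complex.normSq (star u * v) = 1 := by
    intro u v hu hv
    rw [Complex.normSq_mul, Complex.star_def, Complex.normSq_conj, hu, hv, one_mul]
  -- The case `b = 1` is applied to the matrix of `b = I`, whose entry `(i, j)` is purely imaginary.
  have horth : (star u * v * star (star u' * v')).re = 0 := by
    have h1 := hr (rankOne (Pi.single i 1 + Pi.single j Complex.I))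
    rw [huv', rankOne_apply, rankOne_apply] at h1
    simp only [Pi.add_apply, Pi.single_eq_same, Pi.single_eq_of_ne hij, Pi.single_eq_of_ne hij.symm,
      add_zero, zero_add, one_mul, Complex.star_def, Complex.conj_I, Complex.neg_re, Complex.I_re,
      neg_zero] at h1
    rw [star_mul', star_star]
    exact h1
  have hpp := star_mul_self_eq_one (hnp u v hu hv)
  refine ⟨star (star u * v), ?_⟩
  have hcancel : ∀ z w : ℂ, star u * v * z = w → z = star (star u * v) * w := by
    intro z w hzw
    rw [← hzw, ← mul_assoc, hpp, one_mul]
  rcases eq_I_mul_or_eq_neg_I_mul (hnp u v hu hv) (hnp u' v' hu' hv') horth with hI | hI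
  · left
    intro A
    apply hcancel
    have h1 := hr A
    have h2 := hr' A
    rw [hI, mul_assoc Complex.I, Complex.I_mul_re, Complex.I_mul_re] at h2
    rw [one_mul] at h1
    exact Complex.ext h1 (by linarith)
  · right
    intro A
    apply hcancel
    have h1 := hr A
    have h2 := hr' A
    rw [hI, mul_assoc (-Complex.I), neg_mul, Complex.neg_re, Complex.I_mul_re,
      Complex.I_mul_re] at h2
    rw [one_mul] at h1
    rw [← A.star_apply i j]
    exact Complex.ext h1 ((neg_neg _).symm.trans h2)

/-- The entries of `ψ A` are those of `A` or of its transpose, up to a common phase vector. -/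
theorem exists_phases (h : FixesDiagonal ψ) :
    ∃ d : Fin n → ℂ, (∀ i, Complex.normSq (d i) = 1) ∧
      ∀ i j, (∀ A, (ψ A).1 i j = d i * A.1 i j * star (d j)) ∨
        ∀ A, (ψ A).1 i j = d i * A.1 j i * star (d j) := by
  -- The phases are read off the image of the all-ones matrix; being symmetric, it gives the same
  -- constants in both alternatives.
  obtain ⟨d, hd, hdn⟩ := h.exists_rankOne 1
  have hdn' : ∀ i, Complex.normSq (d i) = 1 := fun i => by simp [hdn]
  refine ⟨d, hdn', fun i j => ?_⟩
  by_cases hij : i = j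
  · subst hij
    left
    intro A
    rw [h.map_diag, mul_right_comm, Complex.star_def, Complex.mul_conj, hdn', Complex.ofReal_one,
      one_mul]
  · obtain ⟨c, hc⟩ := h.map_apply_of_ne hij
    have hcd : c = d i * star (d j) := by
      rcases hc with hc | hc <;>
      · have := hc (rankOne 1)
        rw [hd, rankOne_apply, rankOne_apply] at this
        simpa using this.symm
    exact hc.imp (fun hc A => by rw [hc, hcd]; ring) (fun hc A => by rw [hc, hcd]; ring)

theorem uniform_phases (h : FixesDiagonal ψ) :
    ∃ d : Fin n → ℂ, (∀ i, Complex.normSq (d i) = 1) ∧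
      ((∀ i j A, (ψ A).1 i j = d i * A.1 i j * star (d j)) ∨
        ∀ i j A, (ψ A).1 i j = d i * A.1 j i * star (d j)) := by
  obtain ⟨d, hd, hT⟩ := h.exists_phases
  refine ⟨d, hd, ?_⟩
  have hd' : ∀ i, star (d i) * d i = 1 := fun i => star_mul_self_eq_one (hd i)
  have hsymm : ∀ i j, (∀ A, (ψ A).1 i j = d i * A.1 i j * star (d j)) →
      ∀ A, (ψ A).1 j i = d j * A.1 j i * star (d i) := by
    intro i j hij A
    rw [← (ψ A).star_apply i j, hij, ← A.star_apply i j, star_mul', star_mul', star_star]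
    ring
  have hrow : ∀ i j k, i ≠ j → i ≠ k → (∀ A, (ψ A).1 i j = d i * A.1 i j * star (d j)) →
      ∀ A, (ψ A).1 i k = d i * A.1 i k * star (d k) := by
    intro i j k hij hik h1
    refine (hT i k).resolve_right fun h2 => ?_
    -- The test vector has entry `I` at `i` and `1` elsewhere. Its image has rank one, so the
    -- entries `(i, j)` and `(j, k)` determine `(i, k)`, which comes out with the factor `I`; the
    -- transposed alternative gives `-I`.
    obtain ⟨z, hz, hzn⟩ := h.exists_rankOne (Function.update 1 i Complex.I)
    have e1 := h1 (rankOne (Function.update 1 i Complex.I))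
    have e2 := h2 (rankOne (Function.update 1 i Complex.I))
    have e3 : (ψ (rankOne (Function.update 1 i Complex.I))).1 j k = d j * star (d k) := by
      rcases hT j k with h3 | h3 <;>
      · rw [h3, rankOne_apply]
        simp [hij.symm, hik.symm]
    have e4 : star (z j) * z j = 1 := star_mul_self_eq_one (by simp [hzn, hij.symm])
    rw [hz, rankOne_apply] at e1 e2 e3
    rw [rankOne_apply] at e1 e2
    simp only [Function.update_self, Function.update_of_ne hij.symm,
      Function.update_of_ne hik.symm, Pi.one_apply, star_one, mul_one, one_mul, Complex.star_def,
      Complex.conj_I] at e1 e2 e3 e4 hd'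
    have e5 : 2 * Complex.I * d i * (starRingEnd ℂ) (d k) = 0 := by
      linear_combination (-Complex.I * d i * (starRingEnd ℂ) (d k)) * hd' j
        + e2 + z i * (starRingEnd ℂ) (z k) * e4 - z j * (starRingEnd ℂ) (z k) * e1
        - d i * Complex.I * (starRingEnd ℂ) (d j) * e3
    have hdi : d i ≠ 0 := fun h0 => by simpa [h0] using hd i
    have hdk : (starRingEnd ℂ) (d k) ≠ 0 := fun h0 => by
      have := hd' k
      rw [h0, zero_mul] at this
      exact zero_ne_one this
    simp [hdi, hdk] at e5
  by_contra! hne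
  obtain ⟨⟨a, b, A, hA⟩, k, l, B, hB⟩ := hne
  have hab : a ≠ b := by
    rintro rfl
    rcases hT a a with h1 | h1 <;> exact hA (h1 A)
  have hkl : k ≠ l := by
    rintro rfl
    rcases hT k k with h1 | h1 <;> exact hB (h1 B)
  have hkl1 := (hT k l).resolve_right fun h2 => hB (h2 B)
  by_cases hka : k = a
  · subst hka
    exact hA (hrow k l b hkl hab hkl1 A)
  -- The untransposed type spreads along row `k` to `(k, a)`, by symmetry to `(a, k)`, and along row
  -- `a` to `(a, b)`.
  · have h1 := hrow k l a hkl hka hkl1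
    exact hA (hrow a k b (Ne.symm hka) hab (hsymm k a h1) A)

end FixesDiagonal

/-- A real-linear map of Hermitian matrices onto itself on pure states is conjugation by a unitary
matrix, possibly composed with transposition. -/
theorem exists_isUnitaryForm {ψ : Herm (Fin n) →ₗ[ℝ] Herm (Fin n)}
    (h : ψ '' pureStates n = pureStates n) :
    ∃ U ∈ Matrix.unitaryGroup (Fin n) ℂ, IsUnitaryForm U ψ := by
  have hmap : ∀ P ∈ pureStates n, ψ P ∈ pureStates n := fun P hP => h ▸ Set.mem_image_of_mem ψ hP
  have htf := traceForm_map_map h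
  have hsingle : ∀ i : Fin n, rankOne (Pi.single i (1 : ℂ)) ∈ pureStates n := fun i =>
    rankOne_mem_pureStates (by simp)
  choose u hu hψu using fun i => mem_pureStates_iff.1 (hmap _ (hsingle i))
  set V : Matrix (Fin n) (Fin n) ℂ := Matrix.of fun a i => u i a with hV
  have hVV : Vᴴ * V = 1 := by
    ext i j
    have hentry : (Vᴴ * V) i j = star (u i) ⬝ᵥ u j := rfl
    rw [hentry]
    by_cases hij : i = j
    · subst hij
      rw [hu, Matrix.one_apply_eq]
    -- Orthogonality of the columns follows because the trace form of two rank one matrices is the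
    -- squared modulus of the inner product.
    · rw [Matrix.one_apply_ne hij, ← Complex.normSq_eq_zero, ← traceForm_rankOne_rankOne, ← hψu,
        ← hψu, htf, traceForm_rankOne_rankOne]
      simp [hij]
  have hVV' : V * Vᴴ = 1 := mul_eq_one_comm.1 hVV
  have hVt : Vᴴᴴ * Vᴴ = 1 := by rwa [conjTranspose_conjTranspose]
  have hfix : FixesDiagonal (conjHerm Vᴴ ∘ₗ ψ) :=
    { map_pure := fun P hP => conjHerm_mem_pureStates hVt (hmap P hP)
      traceForm_map := fun A B => by
        rw [LinearMap.comp_apply, LinearMap.comp_apply, traceForm_conjHerm hVt, htf]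
      map_single := fun i => by
        rw [LinearMap.comp_apply, hψu, conjHerm_rankOne]
        congr 1
        have : u i = V *ᵥ Pi.single i 1 := by
          rw [mulVec_single_one]
          rfl
        rw [this, mulVec_mulVec, hVV, one_mulVec] }
  obtain ⟨d, hd, hform⟩ := hfix.uniform_phases
  have hback : ∀ A, (ψ A).1 = V * (conjHerm Vᴴ (ψ A)).1 * Vᴴ := by
    intro A
    rw [coe_conjHerm, conjTranspose_conjTranspose]
    calc (ψ A).1 = (V * Vᴴ) * (ψ A).1 * (V * Vᴴ) := by rw [hVV', Matrix.one_mul, Matrix.mul_one]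
      _ = _ := by simp only [Matrix.mul_assoc]
  have hD : (diagonal d)ᴴ * diagonal d = 1 := by
    rw [diagonal_conjTranspose, diagonal_mul_diagonal, ← diagonal_one]
    congr 1
    funext i
    exact star_mul_self_eq_one (hd i)
  have hentry : ∀ (M : Matrix (Fin n) (Fin n) ℂ) i j,
      (diagonal d * M * (diagonal d)ᴴ) i j = d i * M i j * star (d j) := by
    intro M i j
    rw [diagonal_conjTranspose, mul_diagonal, diagonal_mul, Pi.star_apply]
  refine ⟨V * diagonal d, ?_, ?_⟩
  · rw [mem_unitaryGroup_iff', star_eq_conjTranspose, conjTranspose_mul, Matrix.mul_assoc,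
      ← Matrix.mul_assoc Vᴴ, hVV, Matrix.one_mul, hD]
  · refine hform.imp (fun hf A => ?_) (fun hf A => ?_)
    · have : (conjHerm Vᴴ (ψ A)).1 = diagonal d * A.1 * (diagonal d)ᴴ := by
        ext i j
        rw [hentry]
        exact hf i j A
      rw [hback, this, conjTranspose_mul]
      simp only [Matrix.mul_assoc]
    · have : (conjHerm Vᴴ (ψ A)).1 = diagonal d * A.1ᵀ * (diagonal d)ᴴ := by
        ext i j
        rw [hentry]
        exact hf i j A
      rw [hback, this, conjTranspose_mul]
      simp only [Matrix.mul_assoc]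

end Wigner

/-! ### Linear maps preserving product pure states -/

section Product

variable {m n : ℕ}

theorem finrank_herm (n : ℕ) : Module.finrank ℝ (Herm (Fin n)) = n * n := by
  let f : Matrix (Fin n) (Fin n) ℂ →ₗ[ℝ] Herm (Fin n) × Herm (Fin n) :=
    LinearMap.prod realPart imaginaryPart
  have hf : Function.Bijective f := by
    constructor
    · intro X Y h
      have h1 : realPart X = realPart Y := congrArg Prod.fst h
      have h2 : imaginaryPart X = imaginaryPart Y := congrArg Prod.snd h
      rw [← realPart_add_I_smul_imaginaryPart X, ← realPart_add_I_smul_imaginaryPart Y, h1, h2]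
    · rintro ⟨A, B⟩
      refine ⟨(A : Matrix (Fin n) (Fin n) ℂ) + Complex.I • (B : Matrix (Fin n) (Fin n) ℂ), ?_⟩
      refine Prod.ext ?_ ?_
      · change realPart _ = A
        rw [map_add, realPart_I_smul, selfAdjoint.realPart_coe, selfAdjoint.imaginaryPart_coe,
          neg_zero, add_zero]
      · change imaginaryPart _ = B
        rw [map_add, imaginaryPart_I_smul, selfAdjoint.realPart_coe,
          selfAdjoint.imaginaryPart_coe, zero_add]
  have h1 := (LinearEquiv.ofBijective f hf).finrank_eq
  rw [Module.finrank_prod, ← Module.finrank_mul_finrank ℝ ℂ (Matrix (Fin n) (Fin n) ℂ),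
    Complex.finrank_real_complex, Module.finrank_matrix, Module.finrank_self, Fintype.card_fin] at h1
  linarith

/-- Pure states span, so `f` is surjective, and the dimensions are squares of the orders. -/
theorem le_of_pureStates_subset_image {f : Herm (Fin m) →ₗ[ℝ] Herm (Fin n)}
    (h : pureStates n ⊆ f '' pureStates m) : n ≤ m := by
  have hsurj : Function.Surjective f := by
    rw [← LinearMap.range_eq_top, eq_top_iff, ← span_pureStates, Submodule.span_le]
    intro P hP
    obtain ⟨Q, -, hQ⟩ := h hP
    exact ⟨Q, hQ⟩
  have := LinearMap.finrank_le_finrank_of_surjective hsurj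
  rw [finrank_herm, finrank_herm] at this
  exact Nat.mul_self_le_mul_self_iff.1 this

theorem ext_pureStates {E : Type*} [AddCommGroup E] [Module ℝ E]
    {f g : Herm (Fin m) →ₗ[ℝ] Herm (Fin n) →ₗ[ℝ] E}
    (h : ∀ P ∈ pureStates m, ∀ Q ∈ pureStates n, f P Q = g P Q) : f = g :=
  LinearMap.ext_on span_pureStates fun P hP =>
    LinearMap.ext_on span_pureStates fun Q hQ => h P hP Q hQ

theorem image_pureStates_of_isUnitaryForm {U : Matrix (Fin n) (Fin n) ℂ}
    (hU : U ∈ Matrix.unitaryGroup (Fin n) ℂ) {ψ : Herm (Fin n) → Herm (Fin n)}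
    (h : IsUnitaryForm U ψ) : ψ '' pureStates n = pureStates n := by
  have hU1 : Uᴴ * U = 1 := mem_unitaryGroup_iff'.1 hU
  have hU2 : U * Uᴴ = 1 := mem_unitaryGroup_iff.1 hU
  have hUt : Uᴴᴴ * Uᴴ = 1 := by rwa [conjTranspose_conjTranspose]
  have hinv : ∀ P, conjHerm U (conjHerm Uᴴ P) = P := by
    intro P
    apply Subtype.ext
    rw [coe_conjHerm, coe_conjHerm, conjTranspose_conjTranspose]
    calc U * (Uᴴ * P.1 * U) * Uᴴ = (U * Uᴴ) * P.1 * (U * Uᴴ) := by simp only [Matrix.mul_assoc]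
      _ = P.1 := by rw [hU2, Matrix.one_mul, Matrix.mul_one]
  let τ : Herm (Fin n) → Herm (Fin n) := fun A => Herm.mk A.1ᵀ A.isHermitian.transpose
  have hτ : ∀ P ∈ pureStates n, τ P ∈ pureStates n := by
    intro P hP
    exact ⟨(rank_transpose P.1).trans hP.1, (trace_transpose P.1).trans hP.2⟩
  have hττ : ∀ P, τ (τ P) = P := fun P => Subtype.ext (transpose_transpose P.1)
  rcases h with h | h
  · have hψ : ∀ A, ψ A = conjHerm U A := fun A => Subtype.ext (h A)
    apply Set.Subset.antisymm
    · rintro _ ⟨P, hP, rfl⟩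
      rw [hψ]
      exact conjHerm_mem_pureStates hU1 hP
    · intro P hP
      exact ⟨_, conjHerm_mem_pureStates hUt hP, by rw [hψ, hinv]⟩
  · have hψ : ∀ A, ψ A = conjHerm U (τ A) := fun A => Subtype.ext (h A)
    apply Set.Subset.antisymm
    · rintro _ ⟨P, hP, rfl⟩
      rw [hψ]
      exact conjHerm_mem_pureStates hU1 (hτ P hP)
    · intro P hP
      exact ⟨_, hτ _ (conjHerm_mem_pureStates hUt hP), by rw [hψ, hττ, hinv]⟩

variable {Ψ : Herm (Fin m × Fin n) →ₗ[ℝ] Herm (Fin m × Fin n)}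

theorem image_productPure_of_kron {ψ₁ : Herm (Fin m) → Herm (Fin m)}
    {ψ₂ : Herm (Fin n) → Herm (Fin n)} (h₁ : ψ₁ '' pureStates m = pureStates m)
    (h₂ : ψ₂ '' pureStates n = pureStates n)
    (h : ∀ A B, Ψ (kron A B) = kron (ψ₁ A) (ψ₂ B)) :
    Ψ '' productPure m n = productPure m n := by
  rw [productPure, Set.image_image2]
  simp only [h]
  have : Set.image2 kron (ψ₁ '' pureStates m) (ψ₂ '' pureStates n) =
      Set.image2 kron (pureStates m) (pureStates n) := by rw [h₁, h₂]
  rw [← this, Set.image2_image_left, Set.image2_image_right]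

theorem image_productPure_of_kron_swap {Ψ : Herm (Fin n × Fin n) →ₗ[ℝ] Herm (Fin n × Fin n)}
    {ψ₁ ψ₂ : Herm (Fin n) → Herm (Fin n)} (h₁ : ψ₁ '' pureStates n = pureStates n)
    (h₂ : ψ₂ '' pureStates n = pureStates n)
    (h : ∀ A B, Ψ (kron A B) = kron (ψ₂ B) (ψ₁ A)) :
    Ψ '' productPure n n = productPure n n := by
  rw [productPure, Set.image_image2]
  simp only [h]
  rw [Set.image2_swap]
  have : Set.image2 kron (ψ₂ '' pureStates n) (ψ₁ '' pureStates n) =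
      Set.image2 kron (pureStates n) (pureStates n) := by rw [h₁, h₂]
  rw [← this, Set.image2_image_left, Set.image2_image_right]

/-- A linear bijection of the product pure states splits as a tensor product of two maps,
possibly after exchanging the factors. -/
theorem splits_or_swaps (h : Ψ '' productPure m n = productPure m n) :
    ((∀ P ∈ pureStates m, ∀ Q ∈ pureStates n, ∀ Q' ∈ pureStates n,
        ptraceRight m n (Ψ (kron P Q)) = ptraceRight m n (Ψ (kron P Q'))) ∧
      ∀ Q ∈ pureStates n, ∀ P ∈ pureStates m, ∀ P' ∈ pureStates m,
        ptraceLeft m n (Ψ (kron P Q)) = ptraceLeft m n (Ψ (kron P' Q))) ∨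
    ((∀ Q ∈ pureStates n, ∀ P ∈ pureStates m, ∀ P' ∈ pureStates m,
        ptraceRight m n (Ψ (kron P Q)) = ptraceRight m n (Ψ (kron P' Q))) ∧
      ∀ P ∈ pureStates m, ∀ Q ∈ pureStates n, ∀ Q' ∈ pureStates n,
        ptraceLeft m n (Ψ (kron P Q)) = ptraceLeft m n (Ψ (kron P Q'))) := by
  have hinj := (bijective_of_image_span span_productPure h).1
  have hmem : ∀ P ∈ pureStates m, ∀ Q ∈ pureStates n, Ψ (kron P Q) ∈ productPure m n :=
    fun P hP Q hQ => h ▸ Set.mem_image_of_mem Ψ (kron_mem_productPure hP hQ)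
  have hdec := fun (p : pureStates m) (q : pureStates n) =>
    mem_productPure_iff.1 (hmem p.1 p.2 q.1 q.2)
  have key := factor_or_swap (X := pureStates m) (Y := pureStates n)
    (F := fun p q => ⟨_, (hdec p q).1⟩) (G := fun p q => ⟨_, (hdec p q).2.1⟩) ?_ ?_ ?_ ?_
    (subsingleton_or_three_pureStates m) (subsingleton_or_three_pureStates n)
  · simpa only [Subtype.forall, Subtype.mk.injEq] using key
  · intro p q p' q' h1 h2
    have h3 : kron p.1 q.1 = kron p'.1 q'.1 := by
      apply hinj
      rw [← (hdec p q).2.2, ← (hdec p' q').2.2, Subtype.mk.inj h1, Subtype.mk.inj h2]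
    constructor
    · apply Subtype.ext
      rw [← ptraceRight_kron p.1 q.2.2, h3, ptraceRight_kron p'.1 q'.2.2]
    · apply Subtype.ext
      rw [← ptraceLeft_kron q.1 p.2.2, h3, ptraceLeft_kron q'.1 p'.2.2]
  · intro x y
    have hxy := kron_mem_productPure x.2 y.2
    rw [← h] at hxy
    obtain ⟨_, ⟨P, hP, Q, hQ, rfl⟩, hPQ⟩ := hxy
    refine ⟨⟨P, hP⟩, ⟨Q, hQ⟩, Subtype.ext ?_, Subtype.ext ?_⟩
    · simp only [hPQ, ptraceRight_kron x.1 y.2.2]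
    · simp only [hPQ, ptraceLeft_kron y.1 x.2.2]
  · intro q
    refine forall_eq_or_forall_eq fun p p' => ?_
    simp only [Subtype.mk.injEq]
    -- With `q` fixed, `P ↦ Ψ (kron P q)` is linear and sends pure states to product pure states, so
    -- the row falls under the dichotomy.
    exact ptrace_eq_or_eq (Ψ ∘ₗ (kronₗ m n).flip q.1) (fun P hP => hmem P hP q.1 q.2) p.2 p'.2
  · intro p
    refine forall_eq_or_forall_eq fun q q' => ?_
    simp only [Subtype.mk.injEq]
    exact ptrace_eq_or_eq (Ψ ∘ₗ kronₗ m n p.1) (fun Q hQ => hmem p.1 p.2 Q hQ) q.2 q'.2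

/-- The factor maps are partial traces of `Ψ` with the other argument frozen at `P₀` or `Q₀`. This
makes them linear, and `splits_or_swaps` removes the dependence on the frozen argument. -/
theorem exists_kron_of_image_productPure (h : Ψ '' productPure m n = productPure m n)
    {P₀ : Herm (Fin m)} (hP₀ : P₀ ∈ pureStates m) {Q₀ : Herm (Fin n)} (hQ₀ : Q₀ ∈ pureStates n) :
    (∃ (ψ₁ : Herm (Fin m) →ₗ[ℝ] Herm (Fin m)) (ψ₂ : Herm (Fin n) →ₗ[ℝ] Herm (Fin n)),
      ψ₁ '' pureStates m = pureStates m ∧ ψ₂ '' pureStates n = pureStates n ∧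
        ∀ A B, Ψ (kron A B) = kron (ψ₁ A) (ψ₂ B)) ∨
    ∃ (χ₁ : Herm (Fin m) →ₗ[ℝ] Herm (Fin n)) (χ₂ : Herm (Fin n) →ₗ[ℝ] Herm (Fin m)),
      χ₁ '' pureStates m = pureStates n ∧ χ₂ '' pureStates n = pureStates m ∧
        ∀ A B, Ψ (kron A B) = kron (χ₂ B) (χ₁ A) := by
  have hmem : ∀ P ∈ pureStates m, ∀ Q ∈ pureStates n, Ψ (kron P Q) ∈ productPure m n :=
    fun P hP Q hQ => h ▸ Set.mem_image_of_mem Ψ (kron_mem_productPure hP hQ)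
  have hdec := fun P hP Q hQ => mem_productPure_iff.1 (hmem P hP Q hQ)
  have hsurj : ∀ P' ∈ pureStates m, ∀ Q' ∈ pureStates n, ∃ P ∈ pureStates m,
      ∃ Q ∈ pureStates n, ptraceRight m n (Ψ (kron P Q)) = P' ∧
        ptraceLeft m n (Ψ (kron P Q)) = Q' := by
    intro P' hP' Q' hQ'
    have hxy := kron_mem_productPure hP' hQ'
    rw [← h] at hxy
    obtain ⟨_, ⟨P, hP, Q, hQ, rfl⟩, hPQ⟩ := hxy
    exact ⟨P, hP, Q, hQ, by rw [hPQ, ptraceRight_kron P' hQ'.2],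
      by rw [hPQ, ptraceLeft_kron Q' hP'.2]⟩
  rcases splits_or_swaps h with ⟨hF, hG⟩ | ⟨hF, hG⟩
  · left
    let ψ₁ := ptraceRight m n ∘ₗ Ψ ∘ₗ (kronₗ m n).flip Q₀
    let ψ₂ := ptraceLeft m n ∘ₗ Ψ ∘ₗ kronₗ m n P₀
    refine ⟨ψ₁, ψ₂, ?_, ?_, ?_⟩
    · apply Set.Subset.antisymm
      · rintro _ ⟨P, hP, rfl⟩
        exact (hdec P hP Q₀ hQ₀).1
      · intro P' hP'
        obtain ⟨P, hP, Q, hQ, h1, -⟩ := hsurj P' hP' Q₀ hQ₀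
        exact ⟨P, hP, (hF P hP Q₀ hQ₀ Q hQ).trans h1⟩
    · apply Set.Subset.antisymm
      · rintro _ ⟨Q, hQ, rfl⟩
        exact (hdec P₀ hP₀ Q hQ).2.1
      · intro Q' hQ'
        obtain ⟨P, hP, Q, hQ, -, h1⟩ := hsurj P₀ hP₀ Q' hQ'
        exact ⟨Q, hQ, (hG Q hQ P₀ hP₀ P hP).trans h1⟩
    · have hext : (kronₗ m n).compr₂ Ψ = (kronₗ m n).compl₁₂ ψ₁ ψ₂ :=
        ext_pureStates fun P hP Q hQ => by
        change Ψ (kron P Q) =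
          kron (ptraceRight m n (Ψ (kron P Q₀))) (ptraceLeft m n (Ψ (kron P₀ Q)))
        rw [hF P hP Q₀ hQ₀ Q hQ, hG Q hQ P₀ hP₀ P hP, (hdec P hP Q hQ).2.2]
      exact fun A B => LinearMap.congr_fun₂ hext A B
  · right
    let χ₁ := ptraceLeft m n ∘ₗ Ψ ∘ₗ (kronₗ m n).flip Q₀
    let χ₂ := ptraceRight m n ∘ₗ Ψ ∘ₗ kronₗ m n P₀
    refine ⟨χ₁, χ₂, ?_, ?_, ?_⟩
    · apply Set.Subset.antisymm
      · rintro _ ⟨P, hP, rfl⟩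
        exact (hdec P hP Q₀ hQ₀).2.1
      · intro Q' hQ'
        obtain ⟨P, hP, Q, hQ, -, h1⟩ := hsurj P₀ hP₀ Q' hQ'
        exact ⟨P, hP, (hG P hP Q₀ hQ₀ Q hQ).trans h1⟩
    · apply Set.Subset.antisymm
      · rintro _ ⟨Q, hQ, rfl⟩
        exact (hdec P₀ hP₀ Q hQ).1
      · intro P' hP'
        obtain ⟨P, hP, Q, hQ, h1, -⟩ := hsurj P' hP' Q₀ hQ₀
        exact ⟨Q, hQ, (hF Q hQ P₀ hP₀ P hP).trans h1⟩
    · have hext : (kronₗ m n).compr₂ Ψ = ((kronₗ m n).compl₁₂ χ₂ χ₁).flip :=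
        ext_pureStates fun P hP Q hQ => by
          change Ψ (kron P Q) =
            kron (ptraceRight m n (Ψ (kron P₀ Q))) (ptraceLeft m n (Ψ (kron P Q₀)))
          rw [hF Q hQ P₀ hP₀ P hP, hG P hP Q₀ hQ₀ Q hQ, (hdec P hP Q hQ).2.2]
      exact fun A B => LinearMap.congr_fun₂ hext A B

theorem pureStates_nonempty (hn : n ≠ 0) : (pureStates n).Nonempty :=
  ⟨rankOne (Pi.single ⟨0, Nat.pos_of_ne_zero hn⟩ 1), rankOne_mem_pureStates (by simp)⟩

theorem isUnitaryForm_one_id : IsUnitaryForm (1 : Matrix (Fin n) (Fin n) ℂ) id :=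
  Or.inl fun A => by simp

end Product

end SepStates

/-! ### The equivalence -/

theorem theorem2p3 (m n : ℕ)
    (Ψ : SepStates.Herm (Fin m × Fin n) →ₗ[ℝ] SepStates.Herm (Fin m × Fin n)) :
    List.TFAE [
      Ψ '' SepStates.productPure m n = SepStates.productPure m n,
      Ψ '' SepStates.separable m n = SepStates.separable m n,
      ∃ U ∈ Matrix.unitaryGroup (Fin m) ℂ, ∃ V ∈ Matrix.unitaryGroup (Fin n) ℂ,
      ∃ ψ₁ : SepStates.Herm (Fin m) → SepStates.Herm (Fin m),
      ∃ ψ₂ : SepStates.Herm (Fin n) → SepStates.Herm (Fin n),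
        SepStates.IsUnitaryForm U ψ₁ ∧ SepStates.IsUnitaryForm V ψ₂ ∧
        ((∀ (A : SepStates.Herm (Fin m)) (B : SepStates.Herm (Fin n)),
            Ψ (SepStates.kron A B) = SepStates.kron (ψ₁ A) (ψ₂ B)) ∨
         (∃ h : m = n, ∀ (A : SepStates.Herm (Fin m)) (B : SepStates.Herm (Fin n)),
            Ψ (SepStates.kron A B) =
              SepStates.kron (SepStates.castHerm h.symm (ψ₂ B))
                (SepStates.castHerm h (ψ₁ A))))] := by
  open SepStates in
  tfae_have 1 ↔ 2 := (image_separable_iff Ψ).symm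
  tfae_have 1 → 3 := by
    intro h
    -- Order zero admits no pure state to serve as a base point, but then matrices over the product
    -- index have no entries.
    rcases eq_or_ne m 0 with hm | hm
    · subst hm
      exact ⟨1, one_mem _, 1, one_mem _, id, id, isUnitaryForm_one_id, isUnitaryForm_one_id,
        Or.inl fun A B => Subtype.ext (Matrix.ext fun i => i.1.elim0)⟩
    rcases eq_or_ne n 0 with hn | hn
    · subst hn
      exact ⟨1, one_mem _, 1, one_mem _, id, id, isUnitaryForm_one_id, isUnitaryForm_one_id,
        Or.inl fun A B => Subtype.ext (Matrix.ext fun i => i.2.elim0)⟩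
    obtain ⟨P₀, hP₀⟩ := pureStates_nonempty hm
    obtain ⟨Q₀, hQ₀⟩ := pureStates_nonempty hn
    rcases exists_kron_of_image_productPure h hP₀ hQ₀ with
      ⟨ψ₁, ψ₂, h₁, h₂, hk⟩ | ⟨χ₁, χ₂, h₁, h₂, hk⟩
    · obtain ⟨U, hU, hUψ⟩ := exists_isUnitaryForm h₁
      obtain ⟨V, hV, hVψ⟩ := exists_isUnitaryForm h₂
      exact ⟨U, hU, V, hV, ψ₁, ψ₂, hUψ, hVψ, Or.inl hk⟩
    -- Each of `χ₁` and `χ₂` maps pure states onto pure states of the other order, giving both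
    -- inequalities.
    · obtain rfl : m = n := le_antisymm (le_of_pureStates_subset_image h₂.ge)
        (le_of_pureStates_subset_image h₁.ge)
      obtain ⟨U, hU, hUψ⟩ := exists_isUnitaryForm h₁
      obtain ⟨V, hV, hVψ⟩ := exists_isUnitaryForm h₂
      exact ⟨U, hU, V, hV, χ₁, χ₂, hUψ, hVψ, Or.inr ⟨rfl, hk⟩⟩
  tfae_have 3 → 1 := by
    rintro ⟨U, hU, V, hV, ψ₁, ψ₂, hUψ, hVψ, hk | ⟨rfl, hk⟩⟩
    · exact image_productPure_of_kron (image_pureStates_of_isUnitaryForm hU hUψ)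
        (image_pureStates_of_isUnitaryForm hV hVψ) hk
    · exact image_productPure_of_kron_swap (image_pureStates_of_isUnitaryForm hU hUψ)
        (image_pureStates_of_isUnitaryForm hV hVψ) hk
  tfae_finish
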